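/- Let $1<p<\infty$, $p'=p/(p-1)$, let $\Omega\subset\mathbb{R}^n$ ($n\ge 1$) be a bounded domain, $f\in L^{p'}(\Omega,\mathbb{R}^{N\times n})$, $g\in W^{1,p}(\Omega,\mathbb{R}^N)$, and $W^{1,p}_g(\Omega)=g+W^{1,p}_0(\Omega,\mathbb{R}^N)$, where $W^{1,p}_0$ is the closure of $C_c^\infty(\Omega,\mathbb{R}^N)$ in $W^{1,p}$. All equations are understood in the sense of distributions; $|\cdot|$ and $\cdot$ are the Euclidean norm and inner product on $\mathbb{R}^{N\times n}$. Fix $\mu\ge 0$. A map $a\colon\Omega\times\mathbb{R}^{N\times n}\to\mathbb{R}^{N\times n}$ is called an admissible field with constants $\Lambda_a\ge\lambda_a>0$ if - (A1) $a(\cdot,z)$ is measurable in $\Omega$ for every $z$, and for almost every $x\in\Omega$ the map $a(x,\cdot)$ is continuously differentiable on $\mathbb{R}^{N\times n}$ (if $\mu=0$ and $p<2$: continuous on $\mathbb{R}^{N\times n}$ and continuously differentiable on $\mathbb{R}^{N\times n}\setminus\{0\}$); - (A2) for almost every $x\in\Omega$ and all $z,\xi\in\mathbb{R}^{N\times n}$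 (with $z\ne0$ if $\mu=0$ and $p<2$), $\lambda_a(\mu^2+|z|^2)^{\frac{p-2}{2}}|\xi|^2\le\partial_za(x,z)\xi\cdot\xi\le\Lambda_a(\mu^2+|z|^2)^{\frac{p-2}{2}}|\xi|^2$; - (A3) there is $c>0$ with $|a(x,z)|\le c(1+|z|^{p-1})$ for all $x\in\Omega$, $z\in\mathbb{R}^{N\times n}$; - (A4) for almost every $x\in\Omega$ and all $z$ (with $z\neq 0$ if $\mu=0$ and $p<2$), $\partial_za(x,z)$ is symmetric. Let $a$ and $b$ be admissible fields, with the same $\mu$ and with constants $\lambda_a,\Lambda_a$ and $\lambda_b,\Lambda_b$ respectively. Let $0<\lambda_{a,b}\le\Lambda_{a,b}$ be a lower and an upper bound for the eigenvalues of $(\partial_zb(x,z))^{-1}\partial_za(x,z)$, for almost every $x\in\Omega$ and every $z\in\mathbb{R}^{N\times n}$ (with $z\ne0$ if $\mu=0$ and $p\ne2$), and put $$K_{a,b}=\frac{\Lambda_{a,b}-\lambda_{a,b}}{\lambda_{a,b}+\Lambda_{a,b}}.$$ Assume that for every $F\in L^{p'}(\Omega,\mathbb{R}^{N\times n})$ the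 problem $\operatorname{div} b(x,Du)=\operatorname{div}F$ in $\Omega$ has a unique solution in $W^{1,p}_g(\Omega)$, and that $$\frac{\Lambda_b}{\lambda_b}K_{a,b}\Big(\frac{3+\sqrt5}{2}\Big)^{\frac{p-2}{2p}}6^{p-2}(p-1)<1\ \text{ if } p\ge2,\qquad \frac{\Lambda_b}{\lambda_b}K_{a,b}\Big(\frac{3-\sqrt5}{2}\Big)^{\frac{p-2}{4}}\frac{2^{2-p}}{p-1}<1\ \text{ if } p\le2.$$ Then $\operatorname{div}a(x,Du)=\operatorname{div}f$ in $\Omega$ has a unique solution $u\in W^{1,p}_g(\Omega)$. Moreover there are $\gamma>0$ and $R\in(0,1)$ such that for every $u_0\in W^{1,p}_g(\Omega)$ there is a sequence $(u_k)_{k\ge0}$ in $W^{1,p}_g(\Omega)$ starting at $u_0$ with $$\operatorname{div}b(x,Du_{k+1})=\operatorname{div}\big(b(x,Du_k)-\gamma a(x,Du_k)+\gamma f\big)\quad\text{in }\Omega,\qquad k\ge0,$$ and every such sequence is bounded in $W^{1,p}(\Omega)$ and converges to $u$ in $W^{1,p}(\Omega)$ at a linear rate: there is a constant $C$, which may depend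 on the sequence, with $\|u_k-u\|_{W^{1,p}(\Omega)}\le CR^k$ for all $k\ge0$. -/

import Mathlib

open MeasureTheory Filter Topology
open scoped ContDiff

namespace Koshelev

/-- Points of `ℝⁿ`, and vectors in `ℝᴺ`, with the Euclidean norm. -/
abbrev Eu (n : ℕ) : Type := EuclideanSpace ℝ (Fin n)

/-- The matrices `ℝ^{N × n}` with the Euclidean (Frobenius) inner product and norm. -/
abbrev Mat (N n : ℕ) : Type := EuclideanSpace ℝ (Fin N × Fin n)

/-- The exponent `p` as an extended nonnegative number. -/
noncomputable abbrev expo (p : ℝ) : ENNReal := ENNReal.ofReal p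

/-- The Hölder conjugate exponent `p' = p / (p - 1)`. -/
noncomputable abbrev conjExpo (p : ℝ) : ENNReal := ENNReal.ofReal (p / (p - 1))

/-- Smooth functions with compact support contained in `Ω`. -/
structure IsTest {n : ℕ} {F : Type} [NormedAddCommGroup F] [NormedSpace ℝ F]
    (Ω : Set (Eu n)) (φ : Eu n → F) : Prop where
  smooth : ContDiff ℝ ∞ φ
  compact : HasCompactSupport φ
  subset : tsupport φ ⊆ Ω

/-- The classical Jacobian matrix `(Dφ)_{ij} = ∂_j φ_i`. -/
noncomputable def jac {N n : ℕ} (φ : Eu n → Eu N) (x : Eu n) : Mat N n :=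
  WithLp.toLp 2 fun ij => fderiv ℝ φ x (EuclideanSpace.single ij.2 (1 : ℝ)) ij.1

/-- `G` is the weak (distributional) Jacobian matrix of `u` in `Ω`. -/
def HasWeakJac {N n : ℕ} (Ω : Set (Eu n)) (u : Eu n → Eu N) (G : Eu n → Mat N n) : Prop :=
  ∀ φ : Eu n → ℝ, IsTest Ω φ → ∀ (i : Fin N) (j : Fin n),
    ∫ x in Ω, u x i * fderiv ℝ φ x (EuclideanSpace.single j (1 : ℝ))
      = - ∫ x in Ω, G x (i, j) * φ x

/-- Elements of the Sobolev space `W^{1,p}(Ω, ℝᴺ)`: a function in `L^p` together with its weak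
Jacobian matrix, which is also in `L^p`. Elements are representatives, so that equality in
`W^{1,p}` is equality almost everywhere in `Ω`. -/
structure W1p (N : ℕ) {n : ℕ} (Ω : Set (Eu n)) (p : ℝ) where
  toFun : Eu n → Eu N
  grad : Eu n → Mat N n
  memLp : MemLp toFun (expo p) (volume.restrict Ω)
  memLp_grad : MemLp grad (expo p) (volume.restrict Ω)
  hasWeakJac : HasWeakJac Ω toFun grad

/-- The norm `‖u‖_{L^p} + ‖Du‖_{L^p}` of `W^{1,p}(Ω, ℝᴺ)`. -/
noncomputable def W1p.size {N n : ℕ} {Ω : Set (Eu n)} {p : ℝ} (u : W1p N Ω p) : ℝ :=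
  (eLpNorm u.toFun (expo p) (volume.restrict Ω)).toReal
    + (eLpNorm u.grad (expo p) (volume.restrict Ω)).toReal

/-- The distance `‖u - v‖_{W^{1,p}}`. -/
noncomputable def W1p.gap {N n : ℕ} {Ω : Set (Eu n)} {p : ℝ} (u v : W1p N Ω p) : ℝ :=
  (eLpNorm (fun x => u.toFun x - v.toFun x) (expo p) (volume.restrict Ω)).toReal
    + (eLpNorm (fun x => u.grad x - v.grad x) (expo p) (volume.restrict Ω)).toReal

/-- `u ∈ W^{1,p}_g(Ω) = g + W^{1,p}_0(Ω, ℝᴺ)`: the difference `u - g` is a limit, in the norm of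
`W^{1,p}`, of smooth functions with compact support in `Ω`. -/
def W1p.InClass {N n : ℕ} {Ω : Set (Eu n)} {p : ℝ} (u g : W1p N Ω p) : Prop :=
  ∀ ε : ℝ, 0 < ε → ∃ φ : Eu n → Eu N, IsTest Ω φ ∧
    eLpNorm (fun x => u.toFun x - g.toFun x - φ x) (expo p) (volume.restrict Ω)
        ≤ ENNReal.ofReal ε ∧
    eLpNorm (fun x => u.grad x - g.grad x - jac φ x) (expo p) (volume.restrict Ω)
        ≤ ENNReal.ofReal ε

/-- `div a(x, Du) = div F` in `Ω`, in the sense of distributions. -/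
def IsWeakSol {N n : ℕ} {Ω : Set (Eu n)} {p : ℝ} (a : Eu n → Mat N n → Mat N n)
    (F : Eu n → Mat N n) (u : W1p N Ω p) : Prop :=
  ∀ φ : Eu n → Eu N, IsTest Ω φ →
    ∫ x in Ω, inner ℝ (a x (u.grad x)) (jac φ x) = ∫ x in Ω, inner ℝ (F x) (jac φ x)

/-- `u ∈ W^{1,p}_g(Ω)` solves `div a(x, Du) = div F`. -/
def SolvesIn {N n : ℕ} {Ω : Set (Eu n)} {p : ℝ} (a : Eu n → Mat N n → Mat N n)
    (g : W1p N Ω p) (F : Eu n → Mat N n) (u : W1p N Ω p) : Prop :=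
  u.InClass g ∧ IsWeakSol a F u

/-- `div a(x, Du) = div F` has exactly one solution in `W^{1,p}_g(Ω)`. -/
def UniquelySolvable {N n : ℕ} {Ω : Set (Eu n)} {p : ℝ} (a : Eu n → Mat N n → Mat N n)
    (g : W1p N Ω p) (F : Eu n → Mat N n) : Prop :=
  ∃ u : W1p N Ω p, SolvesIn a g F u ∧
    ∀ v : W1p N Ω p, SolvesIn a g F v → v.toFun =ᵐ[volume.restrict Ω] u.toFun

/-- The matrices `z` at which the weight `(μ² + |z|²)^{(p-2)/2}` is finite: all of them, except
for `z = 0` when `μ = 0` and `p < 2`. -/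
def finiteWeight (N n : ℕ) (p μ : ℝ) : Set (Mat N n) :=
  {z | 2 ≤ p ∨ 0 < μ ^ 2 + ‖z‖ ^ 2}

/-- The matrices `z` at which the weight `(μ² + |z|²)^{(p-2)/2}` is finite and positive: all of
them, except for `z = 0` when `μ = 0` and `p ≠ 2`. -/
def regularWeight (N n : ℕ) (p μ : ℝ) : Set (Mat N n) :=
  {z | p = 2 ∨ 0 < μ ^ 2 + ‖z‖ ^ 2}

/-- Elliptic structure fields with controlled `p`-growth, ellipticity constants `lam ≤ Lam` and
parameter `μ`, with symmetric derivative. Where the weight `(μ² + |z|²)^{(p-2)/2}` is infinite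
(that is, at `z = 0` if `μ = 0` and `p < 2`) the field has to be continuous, but no derivative is
asked for, so that the `p`-Laplacian is included for every `p`. -/
structure IsEllipticField {N n : ℕ} (Ω : Set (Eu n)) (p μ lam Lam : ℝ)
    (a : Eu n → Mat N n → Mat N n) : Prop where
  mu_nonneg : 0 ≤ μ
  lam_pos : 0 < lam
  lam_le : lam ≤ Lam
  measurable : ∀ z : Mat N n, AEStronglyMeasurable (fun x => a x z) (volume.restrict Ω)
  continuous : ∀ᵐ x ∂(volume.restrict Ω), Continuous (a x)
  contDiffOn : ∀ᵐ x ∂(volume.restrict Ω), ContDiffOn ℝ 1 (a x) (finiteWeight N n p μ)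
  elliptic : ∀ᵐ x ∂(volume.restrict Ω), ∀ z ∈ finiteWeight N n p μ, ∀ ξ : Mat N n,
    lam * (μ ^ 2 + ‖z‖ ^ 2) ^ ((p - 2) / 2) * ‖ξ‖ ^ 2 ≤ inner ℝ (fderiv ℝ (a x) z ξ) ξ ∧
    inner ℝ (fderiv ℝ (a x) z ξ) ξ ≤ Lam * (μ ^ 2 + ‖z‖ ^ 2) ^ ((p - 2) / 2) * ‖ξ‖ ^ 2
  growth : ∃ c : ℝ, 0 < c ∧ ∀ x ∈ Ω, ∀ z : Mat N n, ‖a x z‖ ≤ c * (1 + ‖z‖ ^ (p - 1))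
  symmetric : ∀ᵐ x ∂(volume.restrict Ω), ∀ z ∈ finiteWeight N n p μ, ∀ ξ η : Mat N n,
    inner ℝ (fderiv ℝ (a x) z ξ) η = inner ℝ ξ (fderiv ℝ (a x) z η)

/-- With `A = ∂_z a` and `B = ∂_z b`, the numbers `l` and `L` are a lower and an upper bound for
all eigenvalues of `B(x,z)⁻¹ A(x,z)`, for almost every `x` and all `z` at which `B(x,z)` is
invertible. -/
def EigenvalueBounds {N n : ℕ} (Ω : Set (Eu n)) (p μ : ℝ)
    (a b : Eu n → Mat N n → Mat N n) (l L : ℝ) : Prop :=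
  ∀ᵐ x ∂(volume.restrict Ω), ∀ z ∈ regularWeight N n p μ, ∀ t : ℝ,
    Module.End.HasEigenvalue
      ((Ring.inverse (fderiv ℝ (b x) z) * fderiv ℝ (a x) z : Mat N n →L[ℝ] Mat N n) :
        Module.End ℝ (Mat N n)) t → l ≤ t ∧ t ≤ L

/-- The constant `K_{a,b} = (Λ_{a,b} - λ_{a,b}) / (λ_{a,b} + Λ_{a,b})`. -/
noncomputable def dispersion (l L : ℝ) : ℝ := (L - l) / (l + L)

/-- The sequence `w` lies in `W^{1,p}_g(Ω)` and satisfies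
`div b(x, Dw_{k+1}) = div (b(x, Dw_k) - γ a(x, Dw_k) + γ f)` for every `k`. -/
def IsKoshelevIteration {N n : ℕ} {Ω : Set (Eu n)} {p : ℝ}
    (a b : Eu n → Mat N n → Mat N n) (g : W1p N Ω p) (f : Eu n → Mat N n) (γ : ℝ)
    (w : ℕ → W1p N Ω p) : Prop :=
  (w 0).InClass g ∧ ∀ k : ℕ, SolvesIn b g
    (fun x => b x ((w k).grad x) - γ • a x ((w k).grad x) + γ • f x) (w (k + 1))

end Koshelev

open Koshelev

/-! Since the derivatives are symmetric and positive, `a(x,·)` and `b(x,·)` are gradients of convex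
potentials (`IsGradientField.hasFDerivAt_segPotential`). Hence `div a(x, Du) = div f` is the Euler
equation of a convex energy `E`. With step size `γ = 1/L`, each step minimises the linearisation of
`E` at the current iterate plus `L` times the integrated Bregman distance of `b`.

Write `D_a`, `D_b` for the Bregman distances of the potentials, and `l ≤ L` for the eigenvalue
bounds. The bounds mean `l ∂b ≤ ∂a ≤ L ∂b` as quadratic forms, and integration along segments gives
`l D_b ≤ D_a ≤ L D_b` (`EigenvalueBounds.bregman_bounds`). For a step from `w` to `w'` and any
competitor `v` in the class, `IsCoerciveField.bregman_step` gives `L ∫ D_b(v,w') ≤ (L - l) ∫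
D_b(v,w) + E(v) - E(w')`. So `∫ D_b(v,·)` contracts as long as the iterates have energy at least
`E(v)`.

The coercivity estimate `|z-w|^p ≤ (C/η) D_b(z,w) + η^p (μ+|y|)^p`, with `y` either argument
(`exists_rpow_le_bregman`), turns this decay into a geometric rate for gradients in `L^p`.
Poincaré's inequality then gives the rate in `W^{1,p}`.

Existence comes from taking `v` to be a later iterate: energies decrease and sublevel sets of `E`
are bounded, so the sequence is Cauchy with a geometric rate, and its limit solves the equation
(`exists_solvesIn`). A solution minimises `E`, so it is an admissible `v` for every iteration
(`exists_gap_le_of_solvesIn`). For uniqueness, a second solution is a constant iteration, which must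
converge to the first. -/

namespace Koshelev

/-! ### Potentials of gradient fields that may fail to be differentiable at the origin. -/

section Pointwise

variable {E : Type*} [NormedAddCommGroup E] [InnerProductSpace ℝ E]

/-- A continuous vector field that is differentiable with symmetric derivative off the origin. -/
structure IsGradientField (A : E → E) : Prop where
  continuous : Continuous A
  differentiableAt : ∀ z, z ≠ 0 → DifferentiableAt ℝ A z
  symmetric : ∀ z, z ≠ 0 → ∀ ξ η : E,
    inner ℝ (fderiv ℝ A z ξ) η = inner ℝ ξ (fderiv ℝ A z η)

/-- The integral of the vector field `A` along the segment from `0` to `z`. -/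
noncomputable def segPotential (A : E → E) (z : E) : ℝ :=
  ∫ t in (0 : ℝ)..1, inner ℝ (A (t • z)) z

/-- The Bregman distance of the potential of `A`. -/
noncomputable def bregman (A : E → E) (z w : E) : ℝ :=
  segPotential A z - segPotential A w - inner ℝ (A w) (z - w)

theorem bregman_self (A : E → E) (z : E) : bregman A z z = 0 := by
  simp [bregman]

/-- A line with nonzero direction meets the origin, the only point where differentiability may fail,
at most once. If the segment misses it, `t₀ = 0` is an arbitrary choice. -/
theorem exists_eq_zero_only {w h : E} (hh : h ≠ 0) :
    ∃ t₀ ∈ Set.Icc (0 : ℝ) 1, ∀ t ∈ Set.Icc (0 : ℝ) 1, t ≠ t₀ → w + t • h ≠ 0 := by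
  by_cases H : ∃ t₀ ∈ Set.Icc (0 : ℝ) 1, w + t₀ • h = 0
  · obtain ⟨t₀, ht₀, h0⟩ := H
    refine ⟨t₀, ht₀, fun t _ hne h1 => ?_⟩
    have h2 : (t - t₀) • h = 0 := by
      rw [sub_smul, sub_eq_zero]
      exact add_left_cancel (h1.trans h0.symm)
    rcases smul_eq_zero.1 h2 with h3 | h3
    · exact hne (sub_eq_zero.1 h3)
    · exact hh h3
  · push Not at H
    exact ⟨0, by simp, fun t ht _ => H t ht⟩

/-- The derivative is integrated along the segment. The one parameter `t₀` at which the segment may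
hit the origin is bridged by continuity: `G` increases on `[0, t₀]` and on `[t₀, 1]`. -/
theorem le_inner_sub_of_segment {A : E → E} (hc : Continuous A)
    (hd : ∀ z, z ≠ 0 → DifferentiableAt ℝ A z) {κ : ℝ} {z w : E}
    (h : ∀ t ∈ Set.Icc (0 : ℝ) 1, w + t • (z - w) ≠ 0 →
      κ * ‖z - w‖ ^ 2 ≤ inner ℝ (fderiv ℝ A (w + t • (z - w)) (z - w)) (z - w)) :
    κ * ‖z - w‖ ^ 2 ≤ inner ℝ (A z - A w) (z - w) := by
  rcases eq_or_ne (z - w) 0 with h0 | h0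
  · simp [h0]
  obtain ⟨t₀, ht₀, hne⟩ := exists_eq_zero_only (w := w) h0
  set v := z - w with hv
  set G : ℝ → ℝ := fun t => inner ℝ (A (w + t • v)) v - κ * t * ‖v‖ ^ 2 with hG
  have hGc : Continuous G := by fun_prop
  have hder : ∀ t ∈ Set.Icc (0 : ℝ) 1, t ≠ t₀ →
      HasDerivAt G (inner ℝ (fderiv ℝ A (w + t • v) v) v - κ * ‖v‖ ^ 2) t := by
    intro t ht hne'
    have h1 : HasDerivAt (fun t : ℝ => w + t • v) v t := by
      simpa using ((hasDerivAt_id t).smul_const v).const_add w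
    have h2 := (hd _ (hne t ht hne')).hasFDerivAt.comp_hasDerivAt t h1
    have h3 := (h2.inner ℝ (hasDerivAt_const t v))
    have h4 : HasDerivAt (fun t : ℝ => κ * t * ‖v‖ ^ 2) (κ * ‖v‖ ^ 2) t := by
      simpa using ((hasDerivAt_id t).const_mul κ).mul_const (‖v‖ ^ 2)
    exact (h3.sub h4).congr_deriv (by simp)
  have hmono : ∀ r s : ℝ, 0 ≤ r → s ≤ 1 → r ≤ s → (∀ t ∈ Set.Ioo r s, t ≠ t₀) → G r ≤ G s := by
    intro r s hr hs hrs hav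
    have : MonotoneOn G (Set.Icc r s) := by
      refine monotoneOn_of_deriv_nonneg (convex_Icc r s) hGc.continuousOn ?_ ?_
      · rw [interior_Icc]
        intro t ht
        exact (hder t ⟨hr.trans ht.1.le, ht.2.le.trans hs⟩
          (hav t ht)).differentiableAt.differentiableWithinAt
      · rw [interior_Icc]
        intro t ht
        have ht' : t ∈ Set.Icc (0 : ℝ) 1 := ⟨hr.trans ht.1.le, ht.2.le.trans hs⟩
        rw [(hder t ht' (hav t ht)).deriv]
        exact sub_nonneg.2 (h t ht' (hne t ht' (hav t ht)))
    exact this ⟨le_rfl, hrs⟩ ⟨hrs, le_rfl⟩ hrs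
  have h1 := hmono 0 t₀ le_rfl ht₀.2 ht₀.1 fun t ht => ht.2.ne
  have h2 := hmono t₀ 1 ht₀.1 le_rfl ht₀.2 fun t ht => ht.1.ne'
  have h3 := h1.trans h2
  have e0 : G 0 = inner ℝ (A w) v := by simp [hG]
  have e1 : G 1 = inner ℝ (A z) v - κ * ‖v‖ ^ 2 := by simp [hG, hv]
  rw [e0, e1] at h3
  rw [inner_sub_left]
  linarith

/-- Tangent inequality for a convex function, convexity being expressed by monotonicity of the
gradient. -/
theorem inner_le_sub_of_gradient {P : E → ℝ} {A : E → E}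
    (hP : ∀ z, HasFDerivAt P (innerSL ℝ (A z)) z)
    (hmono : ∀ z w, 0 ≤ inner ℝ (A z - A w) (z - w)) (z w : E) :
    inner ℝ (A w) (z - w) ≤ P z - P w := by
  set v := z - w with hv
  set G : ℝ → ℝ := fun t => P (w + t • v) - t * inner ℝ (A w) v with hG
  have hder : ∀ t, HasDerivAt G (inner ℝ (A (w + t • v)) v - inner ℝ (A w) v) t := by
    intro t
    have h1 : HasDerivAt (fun t : ℝ => w + t • v) v t := by
      simpa using ((hasDerivAt_id t).smul_const v).const_add w
    have h2 := (hP (w + t • v)).comp_hasDerivAt t h1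
    have h4 : HasDerivAt (fun t : ℝ => t * inner ℝ (A w) v) (inner ℝ (A w) v) t := by
      simpa using (hasDerivAt_id t).mul_const (inner ℝ (A w) v)
    exact (h2.sub h4).congr_deriv (by simp)
  have : MonotoneOn G (Set.Icc 0 1) := by
    refine monotoneOn_of_deriv_nonneg (convex_Icc 0 1)
      (fun t _ => (hder t).continuousAt.continuousWithinAt)
      (fun t _ => (hder t).differentiableAt.differentiableWithinAt) ?_
    rw [interior_Icc]
    intro t ht
    rw [(hder t).deriv, ← inner_sub_left]
    have h5 := hmono (w + t • v) w
    rw [add_sub_cancel_left, real_inner_smul_right] at h5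
    exact nonneg_of_mul_nonneg_right h5 ht.1
  have h6 := this (Set.left_mem_Icc.2 zero_le_one) (Set.right_mem_Icc.2 zero_le_one) zero_le_one
  have e0 : G 0 = P w := by simp [hG]
  have e1 : G 1 = P z - inner ℝ (A w) v := by simp [hG, hv]
  linarith

variable [FiniteDimensional ℝ E]

/-- At the origin, continuity of `A` suffices. Elsewhere the Poincaré lemma yields a primitive on a
convex open set avoiding the origin, and this primitive differs from `segPotential A` by a constant.
-/
theorem IsGradientField.hasFDerivAt_segPotential {A : E → E} (hA : IsGradientField A) (z : E) :
    HasFDerivAt (segPotential A) (innerSL ℝ (A z)) z := by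
  have hc := hA.continuous
  rcases eq_or_ne z 0 with rfl | hz
  · rw [hasFDerivAt_iff_isLittleO, Asymptotics.isLittleO_iff]
    intro c hc0
    have h1 : ∀ᶠ y in 𝓝 (0 : E), ‖A y - A 0‖ < c := by
      have : Tendsto (fun y => ‖A y - A 0‖) (𝓝 0) (𝓝 ‖A 0 - A 0‖) :=
        ((hc.sub continuous_const).norm).tendsto 0
      rw [sub_self, norm_zero] at this
      exact this.eventually (gt_mem_nhds hc0)
    obtain ⟨r, hr, hball⟩ := Metric.eventually_nhds_iff_ball.1 h1
    filter_upwards [Metric.ball_mem_nhds (0 : E) hr] with y hy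
    have e : segPotential A y - segPotential A 0 - innerSL ℝ (A 0) (y - 0)
        = ∫ t in (0 : ℝ)..1, inner ℝ (A (t • y) - A 0) y := by
      simp only [segPotential, inner_sub_left, sub_zero, smul_zero, inner_zero_right,
        intervalIntegral.integral_zero, innerSL_apply_apply]
      rw [intervalIntegral.integral_sub]
      · simp
      · exact Continuous.intervalIntegrable (by fun_prop) _ _
      · exact Continuous.intervalIntegrable (by fun_prop) _ _
    rw [e]
    have := intervalIntegral.norm_integral_le_of_norm_le_const (a := (0 : ℝ)) (b := 1)
      (f := fun t : ℝ => inner ℝ (A (t • y) - A 0) y) (C := c * ‖y‖) ?_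
    · simpa using this
    · intro t ht
      rw [Set.uIoc_of_le zero_le_one] at ht
      refine (norm_inner_le_norm _ _).trans ?_
      gcongr
      refine (hball _ ?_).le
      rw [Metric.mem_ball, dist_zero_right, norm_smul, Real.norm_of_nonneg ht.1.le]
      rw [Metric.mem_ball, dist_zero_right] at hy
      nlinarith [norm_nonneg y, ht.2]
  -- An open half-space containing `z`: convex, stable under positive scaling, and away from the
  -- origin.
  · set s : Set E := {y | 0 < inner ℝ z y} with hs
    have hso : IsOpen s := isOpen_lt continuous_const (by fun_prop)
    have hsc : Convex ℝ s := by
      have : s = (innerSL ℝ z) ⁻¹' Set.Ioi 0 := by ext y; simp [hs]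
      rw [this]
      exact (convex_Ioi 0).linear_preimage (innerSL ℝ z).toLinearMap
    have hs0 : ∀ y ∈ s, y ≠ 0 := by
      rintro y hy rfl
      simp [hs] at hy
    have hsmul : ∀ y ∈ s, ∀ t : ℝ, 0 < t → t • y ∈ s := by
      intro y hy t ht
      simp only [hs, Set.mem_ofPred_eq, real_inner_smul_right] at hy ⊢
      positivity
    have hder : ∀ y ∈ s, HasFDerivAt (fun y => innerSL ℝ (A y))
        ((innerSL ℝ : E →L[ℝ] E →L[ℝ] ℝ).comp (fderiv ℝ A y)) y := fun y hy =>
      (innerSL ℝ : E →L[ℝ] E →L[ℝ] ℝ).hasFDerivAt.comp y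
        (hA.differentiableAt y (hs0 y hy)).hasFDerivAt
    have hdiff : DifferentiableOn ℝ (fun y => innerSL ℝ (A y)) s := fun y hy =>
      (hder y hy).differentiableAt.differentiableWithinAt
    obtain ⟨Ψ, hΨ⟩ := hsc.exists_forall_hasFDerivAt_of_fderiv_symmetric hso hdiff (by
        intro y hy ξ η
        rw [(hder y hy).fderiv]
        simp only [ContinuousLinearMap.comp_apply, innerSL_apply_apply]
        rw [hA.symmetric y (hs0 y hy), real_inner_comm])
    have hii : ∀ y : E, ∀ r q : ℝ, IntervalIntegrable (fun t : ℝ => inner ℝ (A (t • y)) y)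
        volume r q := fun y r q => Continuous.intervalIntegrable (by fun_prop) _ _
    have hftc : ∀ y ∈ s, ∀ ε : ℝ, 0 < ε → ε ≤ 1 →
        Ψ y - segPotential A y = Ψ (ε • y) - ∫ t in (0 : ℝ)..ε, inner ℝ (A (t • y)) y := by
      intro y hy ε hε hε1
      have h1 : ∫ t in ε..1, inner ℝ (A (t • y)) y = Ψ ((1 : ℝ) • y) - Ψ (ε • y) := by
        refine intervalIntegral.integral_eq_sub_of_hasDerivAt (f := fun t : ℝ => Ψ (t • y))
          ?_ (hii y _ _)
        intro t ht
        rw [Set.uIcc_of_le hε1] at ht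
        have h2 : HasDerivAt (fun t : ℝ => t • y) y t := by
          simpa using (hasDerivAt_id t).smul_const y
        have := (hΨ _ (hsmul y hy t (hε.trans_le ht.1))).comp_hasDerivAt t h2
        exact this.congr_deriv (by simp)
      have h3 := intervalIntegral.integral_add_adjacent_intervals (hii y 0 ε) (hii y ε 1)
      rw [segPotential, ← h3, h1, one_smul]
      ring
    -- `Ψ` need not be defined sensibly at the boundary point `0`, so both rays are cut off at `ε`.
    -- The leftover integrals and `Ψ (ε • y) - Ψ (ε • y')` are all `O(ε)`.
    have hconst : ∀ y ∈ s, ∀ y' ∈ s, Ψ y - segPotential A y = Ψ y' - segPotential A y' := by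
      intro y hy y' hy'
      set R := max ‖y‖ ‖y'‖ with hR
      obtain ⟨M, hM⟩ : ∃ M, ∀ x ∈ Metric.closedBall (0 : E) R, ‖A x‖ ≤ M :=
        (isCompact_closedBall (0 : E) R).exists_bound_of_continuousOn hc.continuousOn
      have hR0 : 0 ≤ R := (norm_nonneg y).trans (le_max_left _ _)
      have hM0 : 0 ≤ M := (norm_nonneg _).trans (hM 0 (by simpa using hR0))
      have hmem : ∀ x : E, ‖x‖ ≤ R → ∀ t : ℝ, 0 < t → t ≤ 1 → t • x ∈ Metric.closedBall (0 : E) R := by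
        intro x hx t ht ht1
        rw [mem_closedBall_zero_iff, norm_smul, Real.norm_of_nonneg ht.le]
        nlinarith [norm_nonneg x]
      have hsmall : ∀ x : E, ‖x‖ ≤ R → ∀ ε : ℝ, 0 < ε → ε ≤ 1 →
          |∫ t in (0 : ℝ)..ε, inner ℝ (A (t • x)) x| ≤ M * R * ε := by
        intro x hx ε hε hε1
        have := intervalIntegral.norm_integral_le_of_norm_le_const (a := (0 : ℝ)) (b := ε)
          (f := fun t : ℝ => inner ℝ (A (t • x)) x) (C := M * R) ?_
        · simpa [abs_of_pos hε] using this
        · intro t ht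
          rw [Set.uIoc_of_le hε.le] at ht
          refine (norm_inner_le_norm _ _).trans ?_
          gcongr
          exact hM _ (hmem x hx t ht.1 (ht.2.trans hε1))
      have hbound : ∀ ε : ℝ, 0 < ε → ε ≤ 1 →
          |(Ψ y - segPotential A y) - (Ψ y' - segPotential A y')| ≤ (4 * M * R) * ε := by
        intro ε hε hε1
        rw [hftc y hy ε hε hε1, hftc y' hy' ε hε hε1]
        have h1 := hsmall y (le_max_left _ _) ε hε hε1
        have h2 := hsmall y' (le_max_right _ _) ε hε hε1
        have h3 : ‖Ψ (ε • y) - Ψ (ε • y')‖ ≤ M * ‖ε • y - ε • y'‖ := by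
          refine (hsc.inter (convex_closedBall (0 : E) R)).norm_image_sub_le_of_norm_hasFDerivWithin_le
            (f' := fun x => innerSL ℝ (A x)) (fun x hx => (hΨ x hx.1).hasFDerivWithinAt) ?_
            ⟨hsmul y' hy' ε hε, hmem y' (le_max_right _ _) ε hε hε1⟩
            ⟨hsmul y hy ε hε, hmem y (le_max_left _ _) ε hε hε1⟩
          intro x hx
          rw [innerSL_apply_norm]
          exact hM x hx.2
        rw [← smul_sub, norm_smul, Real.norm_of_nonneg hε.le, Real.norm_eq_abs] at h3
        have h4 : ‖y - y'‖ ≤ 2 * R := by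
          have h5 := norm_sub_le y y'
          have h6 := le_max_left ‖y‖ ‖y'‖
          have h7 := le_max_right ‖y‖ ‖y'‖
          linarith
        have h5 : M * (ε * ‖y - y'‖) ≤ M * (ε * (2 * R)) := by gcongr
        rw [abs_le] at *
        constructor <;> linarith [h1.1, h1.2, h2.1, h2.2, h3.1, h3.2]
      have hlim : Tendsto (fun ε : ℝ => (4 * M * R) * ε) (𝓝[>] 0) (𝓝 0) := by
        have : Tendsto (fun ε : ℝ => (4 * M * R) * ε) (𝓝 0) (𝓝 ((4 * M * R) * 0)) :=
          (continuous_const.mul continuous_id).tendsto 0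
        rw [mul_zero] at this
        exact this.mono_left nhdsWithin_le_nhds
      have h0 := ge_of_tendsto hlim (by
        filter_upwards [Ioc_mem_nhdsGT (zero_lt_one' ℝ)] with ε hε using hbound ε hε.1 hε.2)
      exact sub_eq_zero.1 (abs_nonpos_iff.1 h0)
    have hzs : z ∈ s := by
      simp only [hs, Set.mem_ofPred_eq, real_inner_self_eq_norm_sq]
      positivity
    have h1 : HasFDerivAt (fun y => Ψ y - (Ψ z - segPotential A z)) (innerSL ℝ (A z)) z :=
      (hΨ z hzs).sub_const _
    refine h1.congr_of_eventuallyEq ?_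
    filter_upwards [hso.mem_nhds hzs] with y hy
    rw [← hconst y hy z hzs]
    ring

end Pointwise

/-! ### Comparison and coercivity of Bregman distances. -/

section BregmanEstimates

variable {E : Type*} [NormedAddCommGroup E] [InnerProductSpace ℝ E] [FiniteDimensional ℝ E]

/-- The combined potential has a positive semidefinite Hessian off the origin, hence is convex. The
coefficients may have opposite signs: `(1, -l)` and `(-1, L)` give the two relative bounds. -/
theorem IsGradientField.bregman_comb_nonneg {A B : E → E} (hA : IsGradientField A)
    (hB : IsGradientField B) {α β : ℝ}
    (h : ∀ y, y ≠ 0 → ∀ ξ : E,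
      0 ≤ α * inner ℝ (fderiv ℝ A y ξ) ξ + β * inner ℝ (fderiv ℝ B y ξ) ξ) (z w : E) :
    0 ≤ α * bregman A z w + β * bregman B z w := by
  have hcont : Continuous fun y => α • A y + β • B y :=
    (hA.continuous.const_smul α).add (hB.continuous.const_smul β)
  have hder : ∀ y, y ≠ 0 → HasFDerivAt (fun y => α • A y + β • B y)
      (α • fderiv ℝ A y + β • fderiv ℝ B y) y := fun y hy =>
    ((hA.differentiableAt y hy).hasFDerivAt.const_smul α).add
      ((hB.differentiableAt y hy).hasFDerivAt.const_smul β)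
  have hmono : ∀ z w : E, 0 ≤ inner ℝ ((α • A z + β • B z) - (α • A w + β • B w)) (z - w) := by
    intro z w
    have := le_inner_sub_of_segment (κ := 0) (z := z) (w := w) hcont
      (fun y hy => (hder y hy).differentiableAt) (by
        intro t _ hy
        rw [(hder _ hy).fderiv]
        simpa [inner_add_left, real_inner_smul_left] using h _ hy (z - w))
    simpa using this
  have hP : ∀ z, HasFDerivAt (fun y => α * segPotential A y + β * segPotential B y)
      (innerSL ℝ (α • A z + β • B z)) z := by
    intro z
    have h1 := ((hA.hasFDerivAt_segPotential z).const_mul α).add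
      ((hB.hasFDerivAt_segPotential z).const_mul β)
    refine h1.congr_fderiv ?_
    ext ξ
    simp
  have := inner_le_sub_of_gradient hP hmono z w
  simp only [inner_add_left, real_inner_smul_left] at this
  simp only [bregman]
  linarith

/-- Lower ellipticity bound with weight `(μ² + |y|²)^{(p-2)/2}` off the origin. -/
def LowerElliptic (p μ lam : ℝ) (A : E → E) : Prop :=
  ∀ y, y ≠ 0 → ∀ ξ : E,
    lam * (μ ^ 2 + ‖y‖ ^ 2) ^ ((p - 2) / 2) * ‖ξ‖ ^ 2 ≤ inner ℝ (fderiv ℝ A y ξ) ξ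

omit [FiniteDimensional ℝ E] in
theorem IsGradientField.monotone {A : E → E} (hA : IsGradientField A) {p μ lam : ℝ}
    (hlam : 0 ≤ lam) (he : LowerElliptic p μ lam A) (z w : E) :
    0 ≤ inner ℝ (A z - A w) (z - w) := by
  have := le_inner_sub_of_segment (κ := 0) (z := z) (w := w) hA.continuous hA.differentiableAt
    (fun t _ hy => by
      refine le_trans ?_ (he _ hy _)
      rw [zero_mul]
      positivity)
  simpa using this

/-- Sum of the tangent inequalities from `w` to the midpoint and from the midpoint to the end. It
reduces coercivity of `bregman` to strong monotonicity over half the displacement. -/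
theorem IsGradientField.inner_midpoint_le_bregman {A : E → E} (hA : IsGradientField A)
    {p μ lam : ℝ} (hlam : 0 ≤ lam) (he : LowerElliptic p μ lam A) (w h : E) :
    inner ℝ (A (w + h) - A w) h ≤ bregman A (w + (2 : ℝ) • h) w := by
  have hm := hA.monotone hlam he
  have h1 := inner_le_sub_of_gradient hA.hasFDerivAt_segPotential hm (w + (2 : ℝ) • h) (w + h)
  have h2 := inner_le_sub_of_gradient hA.hasFDerivAt_segPotential hm (w + h) w
  have e1 : w + (2 : ℝ) • h - (w + h) = h := by rw [two_smul]; abel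
  rw [e1] at h1
  rw [add_sub_cancel_left] at h2
  simp only [bregman, add_sub_cancel_left, real_inner_smul_right, inner_sub_left]
  linarith

theorem IsGradientField.bregman_nonneg {A : E → E} (hA : IsGradientField A)
    {p μ lam : ℝ} (hlam : 0 ≤ lam) (he : LowerElliptic p μ lam A) (z w : E) :
    0 ≤ bregman A z w :=
  sub_nonneg.2 (inner_le_sub_of_gradient hA.hasFDerivAt_segPotential (hA.monotone hlam he) z w)

omit [FiniteDimensional ℝ E] in
/-- Strong monotonicity along a segment on which the weight is bounded below. -/
theorem IsGradientField.le_inner_of_weight {A : E → E} (hA : IsGradientField A)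
    {p μ lam κ : ℝ} (hlam : 0 ≤ lam) (he : LowerElliptic p μ lam A) (w h : E)
    (hκ : ∀ t ∈ Set.Icc (0 : ℝ) 1, w + t • h ≠ 0 →
      κ ≤ (μ ^ 2 + ‖w + t • h‖ ^ 2) ^ ((p - 2) / 2)) :
    lam * κ * ‖h‖ ^ 2 ≤ inner ℝ (A (w + h) - A w) h := by
  have := le_inner_sub_of_segment (κ := lam * κ) (z := w + h) (w := w) hA.continuous
    hA.differentiableAt (by
      rw [add_sub_cancel_left]
      intro t ht hy
      refine le_trans ?_ (he _ hy _)
      have := hκ t ht hy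
      gcongr)
  simpa using this

theorem sq_rpow_half {x : ℝ} (hx : 0 ≤ x) (q : ℝ) : (x ^ 2) ^ (q / 2) = x ^ q := by
  rw [← Real.rpow_natCast, ← Real.rpow_mul hx]
  congr 1
  push_cast
  ring

-- For `p ≥ 2` the weight can be small only near the origin. The first and last quarters of the
-- segment are `|h|/2` apart, so one of them stays at distance at least `|h|/4` from the origin, and
-- monotonicity allows discarding the rest.
omit [FiniteDimensional ℝ E] in
theorem IsGradientField.le_inner_superquadratic {A : E → E} (hA : IsGradientField A)
    {p μ lam : ℝ} (hp : 2 ≤ p) (hlam : 0 ≤ lam) (he : LowerElliptic p μ lam A) (w h : E) :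
    lam * (1 / 4) ^ (p - 1) * ‖h‖ ^ p ≤ inner ℝ (A (w + h) - A w) h := by
  rcases eq_or_ne h 0 with rfl | hh
  · simp [Real.zero_rpow (by linarith : p ≠ 0)]
  have hpos : 0 < ‖h‖ := norm_pos_iff.2 hh
  have hmono := hA.monotone hlam he
  -- The component of `A` along `h` is nondecreasing along the line, so its increment over a quarter
  -- is at most the total increment.
  have hq : ∀ s : ℝ, 0 ≤ s → s ≤ 3 / 4 →
      inner ℝ (A (w + s • h + (1 / 4 : ℝ) • h) - A (w + s • h)) h
        ≤ inner ℝ (A (w + h) - A w) h := by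
    intro s hs0 hs1
    have key : ∀ r q : ℝ, r ≤ q → inner ℝ (A (w + r • h)) h ≤ inner ℝ (A (w + q • h)) h := by
      intro r q hrq
      rcases hrq.eq_or_lt with rfl | hlt
      · exact le_rfl
      have h1 := hmono (w + q • h) (w + r • h)
      have e : w + q • h - (w + r • h) = (q - r) • h := by rw [sub_smul]; abel
      rw [e, real_inner_smul_right, inner_sub_left] at h1
      exact sub_nonneg.1 (nonneg_of_mul_nonneg_right h1 (sub_pos.2 hlt))
    have h1 := key 0 s hs0
    have h2 := key (s + 1 / 4) 1 (by linarith)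
    rw [zero_smul, add_zero] at h1
    rw [one_smul, add_smul, ← add_assoc] at h2
    rw [inner_sub_left, inner_sub_left]
    linarith
  have hw : ∀ s : ℝ, (∀ t ∈ Set.Icc (0 : ℝ) 1,
        1 / 4 * ‖h‖ ≤ ‖w + s • h + t • (1 / 4 : ℝ) • h‖) →
      lam * (1 / 4) ^ (p - 1) * ‖h‖ ^ p
        ≤ inner ℝ (A (w + s • h + (1 / 4 : ℝ) • h) - A (w + s • h)) h := by
    intro s hs
    have h1 := hA.le_inner_of_weight (κ := (1 / 4 * ‖h‖) ^ (p - 2)) hlam he (w + s • h)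
      ((1 / 4 : ℝ) • h) (by
        intro t ht _
        rw [← sq_rpow_half (by positivity : 0 ≤ 1 / 4 * ‖h‖)]
        refine Real.rpow_le_rpow (by positivity) ?_ (by linarith)
        have := pow_le_pow_left₀ (by positivity) (hs t ht) 2
        linarith [sq_nonneg μ])
    rw [real_inner_smul_right, norm_smul] at h1
    have e1 : ‖h‖ ^ p = ‖h‖ ^ (p - 2) * ‖h‖ ^ 2 := by
      rw [← Real.rpow_natCast, ← Real.rpow_add hpos]; norm_num
    have e2 : ((1 : ℝ) / 4) ^ (p - 1) = (1 / 4) ^ (p - 2) * (1 / 4) := by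
      have : p - 1 = (p - 2) + 1 := by ring
      rw [this, Real.rpow_add (by norm_num), Real.rpow_one]
    rw [Real.mul_rpow (by norm_num) hpos.le] at h1
    rw [e1, e2]
    norm_num at h1 ⊢
    linarith
  by_cases H : ∀ t ∈ Set.Icc (0 : ℝ) 1,
      1 / 4 * ‖h‖ ≤ ‖w + (0 : ℝ) • h + t • (1 / 4 : ℝ) • h‖
  · exact (hw 0 H).trans (hq 0 le_rfl (by norm_num))
  · push Not at H
    obtain ⟨t, ht, hlt⟩ := H
    refine (hw (3 / 4) fun s hs => ?_).trans (hq (3 / 4) (by norm_num) le_rfl)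
    have e : w + (3 / 4 : ℝ) • h + s • (1 / 4 : ℝ) • h
        = (w + (0 : ℝ) • h + t • (1 / 4 : ℝ) • h) + (3 / 4 + s * (1 / 4) - t * (1 / 4)) • h := by
      module
    have h1 : ‖(3 / 4 + s * (1 / 4) - t * (1 / 4)) • h‖
        ≤ ‖w + (3 / 4 : ℝ) • h + s • (1 / 4 : ℝ) • h‖
          + ‖w + (0 : ℝ) • h + t • (1 / 4 : ℝ) • h‖ := by
      rw [e]
      have := norm_sub_le ((w + (0 : ℝ) • h + t • (1 / 4 : ℝ) • h)
        + (3 / 4 + s * (1 / 4) - t * (1 / 4)) • h) (w + (0 : ℝ) • h + t • (1 / 4 : ℝ) • h)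
      rwa [add_sub_cancel_left] at this
    rw [norm_smul, Real.norm_of_nonneg (by linarith [ht.2, hs.1])] at h1
    nlinarith [ht.2, hs.1]

-- For `p ≤ 2` the weight decreases in its base, so the upper bound `μ² + |y|² ≤ (μ + |y|)² ≤
-- (S|h|)²` on the segment bounds it from below.
omit [FiniteDimensional ℝ E] in
theorem IsGradientField.le_inner_subquadratic {A : E → E} (hA : IsGradientField A)
    {p μ lam S : ℝ} (hp : p ≤ 2) (hμ : 0 ≤ μ) (hlam : 0 ≤ lam) (he : LowerElliptic p μ lam A)
    (w h : E) (hS0 : 0 < S) (hp0 : 0 < p)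
    (hS : ∀ t ∈ Set.Icc (0 : ℝ) 1, μ + ‖w + t • h‖ ≤ S * ‖h‖) :
    lam * S ^ (p - 2) * ‖h‖ ^ p ≤ inner ℝ (A (w + h) - A w) h := by
  rcases eq_or_ne h 0 with rfl | hh
  · simp [Real.zero_rpow hp0.ne']
  have hpos : 0 < ‖h‖ := norm_pos_iff.2 hh
  have h1 := hA.le_inner_of_weight (κ := (S * ‖h‖) ^ (p - 2)) hlam he w h (by
    intro t ht hy
    have hy' : 0 < ‖w + t • h‖ := norm_pos_iff.2 hy
    rw [← sq_rpow_half (by positivity : 0 ≤ S * ‖h‖)]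
    refine Real.rpow_le_rpow_of_nonpos (by positivity) ?_ (by linarith)
    have := pow_le_pow_left₀ (by positivity) (hS t ht) 2
    nlinarith [mul_nonneg hμ hy'.le])
  have e1 : ‖h‖ ^ p = ‖h‖ ^ (p - 2) * ‖h‖ ^ 2 := by
    rw [← Real.rpow_natCast, ← Real.rpow_add hpos]; norm_num
  rw [Real.mul_rpow hS0.le hpos.le] at h1
  rw [e1]
  linarith

/-- Coercivity of the Bregman distance: it controls `|z - w|^p` up to a small multiple of the
`p`-th power of the size of either argument. -/
theorem exists_rpow_le_bregman (E : Type*) [NormedAddCommGroup E] [InnerProductSpace ℝ E]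
    [FiniteDimensional ℝ E] {p μ lam : ℝ} (hp : 1 < p) (hμ : 0 ≤ μ) (hlam : 0 < lam) :
    ∃ C : ℝ, 0 < C ∧ ∀ A : E → E, IsGradientField A → LowerElliptic p μ lam A →
      ∀ η : ℝ, 0 < η → η ≤ 1 → ∀ z w y : E, y = z ∨ y = w →
        ‖z - w‖ ^ p ≤ C / η * bregman A z w + η ^ p * (μ + ‖y‖) ^ p := by
  have hreg : ∀ z w : E, ∃ h, z = w + (2 : ℝ) • h ∧ z - w = (2 : ℝ) • h := by
    intro z w
    refine ⟨(2 : ℝ)⁻¹ • (z - w), ?_, ?_⟩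
    · rw [smul_inv_smul₀ two_ne_zero]; abel
    · rw [smul_inv_smul₀ two_ne_zero]
  -- For `p ≥ 2` the estimate holds without the error term, and `η ≤ 1` only weakens it.
  rcases le_total 2 p with hp2 | hp2
  · set c := lam * (1 / 4) ^ (p - 1) with hc
    have hc0 : 0 < c := by positivity
    refine ⟨2 ^ p / c, by positivity, ?_⟩
    intro A hA he η hη hη1 z w y _
    obtain ⟨h, rfl, hzw⟩ := hreg z w
    have h1 := (hA.le_inner_superquadratic hp2 hlam.le he w h).trans
      (hA.inner_midpoint_le_bregman hlam.le he w h)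
    rw [hzw, norm_smul, Real.norm_two, Real.mul_rpow two_pos.le (norm_nonneg _)]
    have h0 := hA.bregman_nonneg hlam.le he (w + (2 : ℝ) • h) w
    set b := bregman A (w + (2 : ℝ) • h) w
    have h2 : 2 ^ p * ‖h‖ ^ p ≤ 2 ^ p / c * b := by
      rw [div_mul_eq_mul_div, le_div_iff₀ hc0]
      have : (0 : ℝ) < 2 ^ p := by positivity
      nlinarith
    have h3 : 2 ^ p / c * b ≤ 2 ^ p / c / η * b := by
      rw [div_mul_eq_mul_div (2 ^ p / c)]
      exact le_div_self (by positivity) hη hη1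
    have h4 : 0 ≤ η ^ p * (μ + ‖y‖) ^ p := by positivity
    linarith
  · set c := lam * 4 ^ (p - 2) with hc
    have hc0 : 0 < c := by positivity
    refine ⟨2 ^ p / c, by positivity, ?_⟩
    intro A hA he η hη hη1 z w y hy
    obtain ⟨h, rfl, hzw⟩ := hreg z w
    have h0 := hA.bregman_nonneg hlam.le he (w + (2 : ℝ) • h) w
    have hmid := hA.inner_midpoint_le_bregman hlam.le he w h
    rw [hzw, norm_smul, Real.norm_two]
    set b := bregman A (w + (2 : ℝ) • h) w
    -- A displacement small compared with `y` is absorbed by the error term. Otherwise the whole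
    -- segment has size at most `(4/η)|h|`, so the weight is controlled.
    rcases le_total (2 * ‖h‖) (η * (μ + ‖y‖)) with hcase | hcase
    · have h1 : (2 * ‖h‖) ^ p ≤ (η * (μ + ‖y‖)) ^ p :=
        Real.rpow_le_rpow (by positivity) hcase (by linarith)
      rw [Real.mul_rpow hη.le (by positivity)] at h1
      have : 0 ≤ 2 ^ p / c / η * b := by positivity
      linarith
    · have hM : μ + ‖y‖ ≤ 2 * ‖h‖ / η := by
        rw [le_div_iff₀ hη]; linarith
      have hh : 2 * ‖h‖ ≤ 2 * ‖h‖ / η := le_div_self (by positivity) hη hη1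
      have h1 := hA.le_inner_subquadratic (S := 4 / η) hp2 hμ hlam.le he w h (by positivity)
        (by linarith) (by
          intro t ht
          have h2 : ‖w + t • h‖ ≤ ‖y‖ + 2 * ‖h‖ := by
            rcases hy with rfl | rfl
            · have e : w + t • h = (w + (2 : ℝ) • h) - (2 - t) • h := by module
              rw [e]
              refine (norm_sub_le _ _).trans ?_
              rw [norm_smul (2 - t), Real.norm_of_nonneg (by linarith [ht.2])]
              nlinarith [ht.1, norm_nonneg h]
            · refine (norm_add_le _ _).trans ?_
              rw [norm_smul, Real.norm_of_nonneg ht.1]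
              nlinarith [ht.2, norm_nonneg h]
          have e : 4 / η * ‖h‖ = 2 * ‖h‖ / η + 2 * ‖h‖ / η := by ring
          rw [e]
          linarith)
      -- The loss is `η^(2-p)`, and `0 ≤ 2 - p ≤ 1` makes it no worse than `η`.
      have h2 : (4 / η) ^ (p - 2) ≥ 4 ^ (p - 2) * η := by
        rw [Real.div_rpow (by norm_num) hη.le, div_eq_mul_inv, ← Real.rpow_neg hη.le]
        gcongr
        calc η = η ^ (1 : ℝ) := (Real.rpow_one η).symm
          _ ≤ η ^ (-(p - 2)) := Real.rpow_le_rpow_of_exponent_ge hη hη1 (by linarith)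
      have h3 : c * η * ‖h‖ ^ p ≤ b := by
        refine le_trans ?_ (h1.trans hmid)
        rw [hc, mul_assoc lam]
        gcongr
      rw [Real.mul_rpow two_pos.le (norm_nonneg _)]
      have h4 : 0 ≤ η ^ p * (μ + ‖y‖) ^ p := by positivity
      have h5 : 2 ^ p * ‖h‖ ^ p ≤ 2 ^ p / c / η * b := by
        rw [div_div, div_mul_eq_mul_div, le_div_iff₀ (by positivity)]
        have : (0 : ℝ) < 2 ^ p := by positivity
        nlinarith
      linarith

end BregmanEstimates

/-! ### From eigenvalues of `B⁻¹A` to an ordering of quadratic forms. -/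

section RelativeSpectrum

variable {E : Type*} [NormedAddCommGroup E] [InnerProductSpace ℝ E] [FiniteDimensional ℝ E]

-- A zero of a nonnegative quadratic form is a minimiser, so its first variation, taken in the
-- direction `M ξ`, vanishes.
omit [FiniteDimensional ℝ E] in
theorem apply_eq_zero_of_inner_eq_zero {M : E →L[ℝ] E}
    (hs : ∀ ξ η : E, inner ℝ (M ξ) η = inner ℝ ξ (M η)) (hn : ∀ ξ, 0 ≤ inner ℝ (M ξ) ξ)
    {ξ : E} (h0 : inner ℝ (M ξ) ξ = 0) : M ξ = 0 := by
  by_contra hne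
  have hpos : 0 < ‖M ξ‖ ^ 2 := by positivity
  have key : ∀ s : ℝ, 0 ≤ 2 * s * ‖M ξ‖ ^ 2 + s ^ 2 * inner ℝ (M (M ξ)) (M ξ) := by
    intro s
    have h1 := hn (ξ + s • M ξ)
    simp only [map_add, map_smul, inner_add_left, inner_add_right, real_inner_smul_left,
      real_inner_smul_right, h0, real_inner_self_eq_norm_sq] at h1
    rw [hs (M ξ) ξ, real_inner_self_eq_norm_sq] at h1
    linarith
  set q := inner ℝ (M (M ξ)) (M ξ) with hq
  have hq0 : 0 ≤ q := hn _
  -- Nearly the minimising `s`; the `+ 1` covers `q = 0`.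
  have h2 := key (-(‖M ξ‖ ^ 2) / (q + 1))
  have h3 : 2 * (-(‖M ξ‖ ^ 2) / (q + 1)) * ‖M ξ‖ ^ 2 + (-(‖M ξ‖ ^ 2) / (q + 1)) ^ 2 * q
      = - ((‖M ξ‖ ^ 2) ^ 2 * (q + 2) / (q + 1) ^ 2) := by
    field_simp
    ring
  rw [h3] at h2
  have : 0 < (‖M ξ‖ ^ 2) ^ 2 * (q + 2) / (q + 1) ^ 2 := by positivity
  linarith

theorem isUnit_of_inner_pos {B : E →L[ℝ] E} (hB : ∀ ξ, ξ ≠ 0 → 0 < inner ℝ (B ξ) ξ) :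
    IsUnit B := by
  rw [ContinuousLinearMap.isUnit_iff_isUnit_toLinearMap, LinearMap.isUnit_iff_ker_eq_bot,
    LinearMap.ker_eq_bot']
  intro ξ hξ
  by_contra hne
  have := hB ξ hne
  have e : B ξ = 0 := hξ
  rw [e, inner_zero_left] at this
  exact this.false

/-- An eigenvalue of `B⁻¹A` that bounds the generalized Rayleigh quotient from below. -/
theorem exists_hasEigenvalue_le_inner [Nontrivial E] {A B : E →L[ℝ] E}
    (hAs : ∀ ξ η : E, inner ℝ (A ξ) η = inner ℝ ξ (A η))
    (hBs : ∀ ξ η : E, inner ℝ (B ξ) η = inner ℝ ξ (B η))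
    (hB : ∀ ξ, ξ ≠ 0 → 0 < inner ℝ (B ξ) ξ) :
    ∃ t : ℝ, Module.End.HasEigenvalue ((Ring.inverse B * A : E →L[ℝ] E) : Module.End ℝ E) t ∧
      ∀ ξ, t * inner ℝ (B ξ) ξ ≤ inner ℝ (A ξ) ξ := by
  have hne : (Metric.sphere (0 : E) 1).Nonempty := NormedSpace.sphere_nonempty.2 zero_le_one
  have hcont : ContinuousOn (fun ξ => inner ℝ (A ξ) ξ / inner ℝ (B ξ) ξ)
      (Metric.sphere (0 : E) 1) := by
    refine ContinuousOn.div (by fun_prop) (by fun_prop) fun ξ hξ => ?_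
    exact (hB ξ (ne_zero_of_mem_unit_sphere ⟨ξ, hξ⟩)).ne'
  obtain ⟨ξ₀, hξ₀, hmin⟩ := (isCompact_sphere (0 : E) 1).exists_isMinOn hne hcont
  have hξ0 : ξ₀ ≠ 0 := ne_zero_of_mem_unit_sphere ⟨ξ₀, hξ₀⟩
  set t := inner ℝ (A ξ₀) ξ₀ / inner ℝ (B ξ₀) ξ₀ with ht
  have hle : ∀ ξ, t * inner ℝ (B ξ) ξ ≤ inner ℝ (A ξ) ξ := by
    intro ξ
    rcases eq_or_ne ξ 0 with rfl | hξ
    · simp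
    have hn : 0 < ‖ξ‖ := norm_pos_iff.2 hξ
    have h1 : t ≤ inner ℝ (A (‖ξ‖⁻¹ • ξ)) (‖ξ‖⁻¹ • ξ) / inner ℝ (B (‖ξ‖⁻¹ • ξ)) (‖ξ‖⁻¹ • ξ) :=
      hmin (by simp [norm_smul, hn.ne'])
    simp only [map_smul, real_inner_smul_left, real_inner_smul_right] at h1
    rw [mul_div_mul_left _ _ (by positivity), mul_div_mul_left _ _ (by positivity),
      le_div_iff₀ (hB ξ hξ)] at h1
    exact h1
  refine ⟨t, ?_, hle⟩
  -- `t` is the minimum of the Rayleigh quotient, so the form of `A - tB` is nonnegative and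
  -- vanishes at the minimiser.
  have hker : (A - t • B) ξ₀ = 0 := by
    refine apply_eq_zero_of_inner_eq_zero ?_ ?_ ?_
    · intro ξ η
      simp [inner_sub_left, inner_sub_right, real_inner_smul_left, real_inner_smul_right, hAs, hBs]
    · intro ξ
      simp only [_root_.sub_apply, _root_.smul_apply, inner_sub_left,
        real_inner_smul_left]
      linarith [hle ξ]
    · simp only [_root_.sub_apply, _root_.smul_apply, inner_sub_left,
        real_inner_smul_left, ht]
      rw [div_mul_cancel₀ _ (hB ξ₀ hξ0).ne', sub_self]
  have hAξ : A ξ₀ = t • B ξ₀ := by simpa [sub_eq_zero] using hker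
  refine Module.End.hasEigenvalue_of_hasEigenvector (x := ξ₀) ⟨?_, hξ0⟩
  rw [Module.End.mem_eigenspace_iff]
  change Ring.inverse B (A ξ₀) = t • ξ₀
  rw [hAξ, map_smul]
  have : (Ring.inverse B * B) ξ₀ = ξ₀ := by
    rw [Ring.inverse_mul_cancel _ (isUnit_of_inner_pos hB)]; rfl
  rw [mul_apply_eq_comp] at this
  rw [this]

/-- The extreme values of the generalized Rayleigh quotient are eigenvalues; the upper one is the
lower one for `-A`, up to sign. -/
theorem inner_bounds_of_eigenvalue_bounds {A B : E →L[ℝ] E}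
    (hAs : ∀ ξ η : E, inner ℝ (A ξ) η = inner ℝ ξ (A η))
    (hBs : ∀ ξ η : E, inner ℝ (B ξ) η = inner ℝ ξ (B η))
    (hB : ∀ ξ, ξ ≠ 0 → 0 < inner ℝ (B ξ) ξ) {l L : ℝ}
    (h : ∀ t : ℝ, Module.End.HasEigenvalue
      ((Ring.inverse B * A : E →L[ℝ] E) : Module.End ℝ E) t → l ≤ t ∧ t ≤ L) (ξ : E) :
    l * inner ℝ (B ξ) ξ ≤ inner ℝ (A ξ) ξ ∧ inner ℝ (A ξ) ξ ≤ L * inner ℝ (B ξ) ξ := by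
  rcases eq_or_ne ξ 0 with rfl | hξ
  · simp
  have : Nontrivial E := ⟨ξ, 0, hξ⟩
  constructor
  · obtain ⟨t, ht, hle⟩ := exists_hasEigenvalue_le_inner hAs hBs hB
    exact (mul_le_mul_of_nonneg_right (h t ht).1 (hB ξ hξ).le).trans (hle ξ)
  · obtain ⟨t, ht, hle⟩ := exists_hasEigenvalue_le_inner (A := -A) (B := B)
      (fun ξ η => by simp [hAs]) hBs hB
    have h1 : Module.End.HasEigenvalue
        ((Ring.inverse B * A : E →L[ℝ] E) : Module.End ℝ E) (-t) := by
      obtain ⟨x, hx⟩ := ht.exists_hasEigenvector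
      refine Module.End.hasEigenvalue_of_hasEigenvector (x := x) ⟨?_, hx.2⟩
      rw [Module.End.mem_eigenspace_iff]
      have h2 := hx.apply_eq_smul
      change Ring.inverse B (-(A x)) = t • x at h2
      change Ring.inverse B (A x) = (-t) • x
      rw [map_neg] at h2
      rw [neg_smul, ← h2, neg_neg]
    have h2 := hle ξ
    have h3 := mul_le_mul_of_nonneg_right (h _ h1).2 (hB ξ hξ).le
    simp only [_root_.neg_apply, inner_neg_left] at h2
    linarith

end RelativeSpectrum

/-! ### Measurability of superpositions. -/

section Caratheodory

variable {α E F : Type*} [MeasurableSpace α] {ν : Measure α} [NormedAddCommGroup E]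
  [NormedAddCommGroup F]

/-- Superposition with a Carathéodory function preserves measurability. -/
theorem aestronglyMeasurable_superposition {a : α → E → F}
    (hm : ∀ z, AEStronglyMeasurable (fun x => a x z) ν) (hc : ∀ᵐ x ∂ν, Continuous (a x))
    {w : α → E} (hw : AEStronglyMeasurable w ν) :
    AEStronglyMeasurable (fun x => a x (w x)) ν := by
  -- For a simple function the superposition is a finite sum over fibres; continuity of `a x` then
  -- passes to limits of simple functions.
  have hsimple : ∀ s : SimpleFunc α E, AEStronglyMeasurable (fun x => a x (s x)) ν := by
    intro s
    have e : (fun x => a x (s x))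
        = fun x => ∑ z ∈ s.range, (s ⁻¹' {z}).indicator (fun x => a x z) x := by
      funext x
      rw [Finset.sum_eq_single_of_mem (s x) (SimpleFunc.mem_range_self s x)]
      · simp
      · intro z _ hz
        simp [Set.indicator, hz.symm]
    rw [e]
    exact Finset.aestronglyMeasurable_fun_sum _ fun z _ =>
      (hm z).indicator (s.measurableSet_fiber z)
  obtain ⟨w', hw', hww'⟩ := hw
  refine aestronglyMeasurable_of_tendsto_ae atTop (fun n => hsimple (hw'.approx n)) ?_
  filter_upwards [hc, hww'] with x hx hxx
  rw [hxx]
  exact (hx.tendsto (w' x)).comp (hw'.tendsto_approx x)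

end Caratheodory

theorem aestronglyMeasurable_segPotential {α E : Type*} [MeasurableSpace α] {ν : Measure α}
    [SFinite ν] [NormedAddCommGroup E] [InnerProductSpace ℝ E] {a : α → E → E}
    (hm : ∀ z, AEStronglyMeasurable (fun x => a x z) ν) (hc : ∀ᵐ x ∂ν, Continuous (a x))
    {w : α → E} (hw : AEStronglyMeasurable w ν) :
    AEStronglyMeasurable (fun x => segPotential (a x) (w x)) ν := by
  simp only [segPotential, intervalIntegral.integral_of_le zero_le_one]
  refine AEStronglyMeasurable.integral_prod_right'
    (f := fun q : α × ℝ => inner ℝ (a q.1 (q.2 • w q.1)) (w q.1)) ?_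
  have hw1 : AEStronglyMeasurable (fun q : α × ℝ => w q.1)
      (ν.prod (volume.restrict (Set.Ioc (0 : ℝ) 1))) := hw.comp_fst
  refine AEStronglyMeasurable.inner ?_ hw1
  refine aestronglyMeasurable_superposition (a := fun q : α × ℝ => a q.1)
    (w := fun q : α × ℝ => q.2 • w q.1) (fun z => (hm z).comp_fst) ?_ ?_
  · exact Measure.quasiMeasurePreserving_fst.ae hc
  · exact AEStronglyMeasurable.smul measurable_snd.aestronglyMeasurable hw1

/-! ### Hölder duality between `L^p` and `L^{p'}` in terms of real integrals. -/

section Exponents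

variable {α : Type*} [MeasurableSpace α] {ν : Measure α} {E : Type*} [NormedAddCommGroup E]

theorem holderConjugate_of_one_lt {p : ℝ} (hp : 1 < p) : (p / (p - 1)).HolderConjugate p :=
  (Real.HolderConjugate.conjExponent hp).symm

theorem one_le_expo {p : ℝ} (hp : 1 < p) : 1 ≤ expo p := by
  rw [ENNReal.one_le_ofReal]; exact hp.le

theorem expo_ne_zero {p : ℝ} (hp : 1 < p) : expo p ≠ 0 :=
  (zero_lt_one.trans_le (one_le_expo hp)).ne'

theorem toReal_expo {p : ℝ} (hp : 1 < p) : (expo p).toReal = p :=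
  ENNReal.toReal_ofReal (by linarith)

theorem integrable_norm_rpow_of_memLp {p : ℝ} (hp : 1 < p) {w : α → E}
    (hw : MemLp w (expo p) ν) : Integrable (fun x => ‖w x‖ ^ p) ν := by
  have := hw.integrable_norm_rpow (expo_ne_zero hp) ENNReal.ofReal_ne_top
  rwa [toReal_expo hp] at this

theorem toReal_eLpNorm_eq {p : ℝ} (hp : 1 < p) {w : α → E} (hw : MemLp w (expo p) ν) :
    (eLpNorm w (expo p) ν).toReal = (∫ x, ‖w x‖ ^ p ∂ν) ^ p⁻¹ := by
  rw [hw.eLpNorm_eq_integral_rpow_norm (expo_ne_zero hp) ENNReal.ofReal_ne_top, toReal_expo hp,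
    ENNReal.toReal_ofReal]
  exact Real.rpow_nonneg (integral_nonneg fun x => by positivity) _

theorem integral_norm_rpow_eq {p : ℝ} (hp : 1 < p) {w : α → E} (hw : MemLp w (expo p) ν) :
    ∫ x, ‖w x‖ ^ p ∂ν = (eLpNorm w (expo p) ν).toReal ^ p := by
  rw [toReal_eLpNorm_eq hp hw, Real.rpow_inv_rpow _ (by linarith)]
  exact integral_nonneg fun x => by positivity

theorem integral_norm_mul_norm_le {E' : Type*} [NormedAddCommGroup E'] {p : ℝ} (hp : 1 < p)
    {F : α → E'} {h : α → E} (hF : MemLp F (conjExpo p) ν) (hh : MemLp h (expo p) ν) :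
    ∫ x, ‖F x‖ * ‖h x‖ ∂ν
      ≤ (eLpNorm F (conjExpo p) ν).toReal * (eLpNorm h (expo p) ν).toReal := by
  have hc := holderConjugate_of_one_lt hp
  have := integral_mul_norm_le_Lp_mul_Lq hc hF.norm hh.norm
  simp only [norm_norm, one_div] at this
  rwa [← toReal_eLpNorm_eq hp hh, ← toReal_eLpNorm_eq hc.lt hF] at this

theorem integrable_norm_mul_norm {E' : Type*} [NormedAddCommGroup E'] {p : ℝ} (hp : 1 < p)
    {F : α → E'} {h : α → E} (hF : MemLp F (conjExpo p) ν) (hh : MemLp h (expo p) ν) :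
    Integrable (fun x => ‖F x‖ * ‖h x‖) ν := by
  have : (conjExpo p).HolderConjugate (expo p) := (holderConjugate_of_one_lt hp).ennrealOfReal
  exact hF.norm.integrable_mul hh.norm

variable [InnerProductSpace ℝ E]

theorem integrable_inner_of_memLp {p : ℝ} (hp : 1 < p) {F h : α → E}
    (hF : MemLp F (conjExpo p) ν) (hh : MemLp h (expo p) ν) :
    Integrable (fun x => inner ℝ (F x) (h x)) ν :=
  (integrable_norm_mul_norm hp hF hh).mono' (hF.1.inner hh.1)
    (Eventually.of_forall fun _ => norm_inner_le_norm _ _)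

theorem abs_integral_inner_le {p : ℝ} (hp : 1 < p) {F h : α → E}
    (hF : MemLp F (conjExpo p) ν) (hh : MemLp h (expo p) ν) :
    |∫ x, inner ℝ (F x) (h x) ∂ν|
      ≤ (eLpNorm F (conjExpo p) ν).toReal * (eLpNorm h (expo p) ν).toReal := by
  refine le_trans ?_ (integral_norm_mul_norm_le hp hF hh)
  rw [← Real.norm_eq_abs]
  exact norm_integral_le_of_norm_le (integrable_norm_mul_norm hp hF hh)
    (Eventually.of_forall fun x => norm_inner_le_norm (F x) (h x))

end Exponents

/-! ### Integrated estimates for Carathéodory fields. -/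

section Fields

variable {α : Type*} [MeasurableSpace α] {ν : Measure α} [IsFiniteMeasure ν] {E : Type*}
  [NormedAddCommGroup E] [InnerProductSpace ℝ E] [FiniteDimensional ℝ E]

/-- A Carathéodory family of gradient fields with `p`-growth and a uniform lower ellipticity
bound. -/
structure IsCoerciveField (ν : Measure α) (p μ lam : ℝ) (a : α → E → E) : Prop where
  one_lt : 1 < p
  mu_nonneg : 0 ≤ μ
  lam_pos : 0 < lam
  measurable : ∀ z, AEStronglyMeasurable (fun x => a x z) ν
  gradient : ∀ᵐ x ∂ν, IsGradientField (a x)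
  elliptic : ∀ᵐ x ∂ν, LowerElliptic p μ lam (a x)
  growth : ∃ c : ℝ, 0 < c ∧ ∀ᵐ x ∂ν, ∀ z, ‖a x z‖ ≤ c * (1 + ‖z‖ ^ (p - 1))

namespace IsCoerciveField

variable {p μ lam : ℝ} {a : α → E → E} (ha : IsCoerciveField ν p μ lam a)
include ha

omit [IsFiniteMeasure ν] [FiniteDimensional ℝ E] in
theorem ae_continuous : ∀ᵐ x ∂ν, Continuous (a x) := ha.gradient.mono fun _ h => h.continuous

omit [FiniteDimensional ℝ E] in
theorem memLp_one_add_rpow {w : α → E} (hw : MemLp w (expo p) ν) :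
    MemLp (fun x => 1 + ‖w x‖ ^ (p - 1)) (conjExpo p) ν := by
  have h1 : MemLp (fun x => ‖w x‖ ^ (p - 1)) (conjExpo p) ν := by
    have := hw.norm_rpow_div (ENNReal.ofReal (p - 1))
    rw [ENNReal.toReal_ofReal (by linarith [ha.one_lt]),
      ← ENNReal.ofReal_div_of_pos (by linarith [ha.one_lt])] at this
    exact this
  exact (memLp_const (1 : ℝ)).add h1

omit [FiniteDimensional ℝ E] in
theorem memLp_comp {w : α → E} (hw : MemLp w (expo p) ν) :
    MemLp (fun x => a x (w x)) (conjExpo p) ν := by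
  obtain ⟨c, _, hc⟩ := ha.growth
  refine ((ha.memLp_one_add_rpow hw).const_mul c).mono'
    (aestronglyMeasurable_superposition ha.measurable ha.ae_continuous hw.1) ?_
  filter_upwards [hc] with x hx using hx _

omit [FiniteDimensional ℝ E] in
theorem integrable_segPotential {w : α → E} (hw : MemLp w (expo p) ν) :
    Integrable (fun x => segPotential (a x) (w x)) ν := by
  obtain ⟨c, hc0, hc⟩ := ha.growth
  have h1 := (integrable_norm_mul_norm ha.one_lt (ha.memLp_one_add_rpow hw) hw).const_mul c
  refine h1.mono' (aestronglyMeasurable_segPotential ha.measurable ha.ae_continuous hw.1) ?_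
  filter_upwards [hc] with x hx
  have := intervalIntegral.norm_integral_le_of_norm_le_const (a := (0 : ℝ)) (b := 1)
    (f := fun t : ℝ => inner ℝ (a x (t • w x)) (w x))
    (C := c * (‖1 + ‖w x‖ ^ (p - 1)‖ * ‖w x‖)) ?_
  · simpa [segPotential] using this
  · intro t ht
    rw [Set.uIoc_of_le zero_le_one] at ht
    refine (norm_inner_le_norm _ _).trans ?_
    rw [← mul_assoc]
    gcongr
    refine (hx _).trans ?_
    rw [Real.norm_of_nonneg (by positivity)]
    have h2 : ‖t • w x‖ ≤ ‖w x‖ := by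
      rw [norm_smul, Real.norm_of_nonneg ht.1.le]
      exact mul_le_of_le_one_left (norm_nonneg _) ht.2
    have := Real.rpow_le_rpow (norm_nonneg _) h2 (by linarith [ha.one_lt] : 0 ≤ p - 1)
    gcongr

theorem integrable_bregman {v w : α → E} (hv : MemLp v (expo p) ν) (hw : MemLp w (expo p) ν) :
    Integrable (fun x => bregman (a x) (v x) (w x)) ν :=
  ((ha.integrable_segPotential hv).sub (ha.integrable_segPotential hw)).sub
    (integrable_inner_of_memLp ha.one_lt (ha.memLp_comp hw) (hv.sub hw))

omit [IsFiniteMeasure ν] in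
theorem integral_bregman_nonneg (v w : α → E) : 0 ≤ ∫ x, bregman (a x) (v x) (w x) ∂ν := by
  refine integral_nonneg_of_ae ?_
  filter_upwards [ha.gradient, ha.elliptic] with x hx hx'
  exact hx.bregman_nonneg ha.lam_pos.le hx' _ _

omit [FiniteDimensional ℝ E] in
theorem integrable_add_norm_rpow {w : α → E} (hw : MemLp w (expo p) ν) :
    Integrable (fun x => (μ + ‖w x‖) ^ p) ν := by
  have h1 : MemLp (fun x => μ + ‖w x‖) (expo p) ν := (memLp_const μ).add hw.norm
  refine (integrable_norm_rpow_of_memLp ha.one_lt h1).congr (Eventually.of_forall fun x => ?_)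
  have := ha.mu_nonneg
  dsimp only
  rw [Real.norm_of_nonneg (by positivity)]

end IsCoerciveField

/-- `C` is chosen before `η`, so `η` may shrink along the iteration. The choice of `y` lets the
error term involve whichever argument is held fixed. -/
theorem IsCoerciveField.exists_integral_rpow_le (E : Type*) [NormedAddCommGroup E]
    [InnerProductSpace ℝ E] [FiniteDimensional ℝ E] {p μ lam : ℝ} (hp : 1 < p) (hμ : 0 ≤ μ)
    (hlam : 0 < lam) :
    ∃ C : ℝ, 0 < C ∧ ∀ a : α → E → E, IsCoerciveField ν p μ lam a → ∀ η : ℝ, 0 < η → η ≤ 1 →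
      ∀ v w y : α → E, MemLp v (expo p) ν → MemLp w (expo p) ν → y = v ∨ y = w →
        ∫ x, ‖v x - w x‖ ^ p ∂ν
          ≤ C / η * ∫ x, bregman (a x) (v x) (w x) ∂ν + η ^ p * ∫ x, (μ + ‖y x‖) ^ p ∂ν := by
  obtain ⟨C, hC, h⟩ := exists_rpow_le_bregman E hp hμ hlam
  refine ⟨C, hC, fun a ha η hη hη1 v w y hv hw hy => ?_⟩
  have hyL : MemLp y (expo p) ν := by rcases hy with rfl | rfl <;> assumption
  rw [← integral_const_mul, ← integral_const_mul, ← integral_add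
    ((ha.integrable_bregman hv hw).const_mul _) ((ha.integrable_add_norm_rpow hyL).const_mul _)]
  refine integral_mono_ae (integrable_norm_rpow_of_memLp hp (hv.sub hw))
    (((ha.integrable_bregman hv hw).const_mul _).add
      ((ha.integrable_add_norm_rpow hyL).const_mul _)) ?_
  filter_upwards [ha.gradient, ha.elliptic] with x hx hx'
  exact h (a x) hx hx' η hη hη1 _ _ _ (by rcases hy with rfl | rfl <;> simp)

theorem add_rpow_le {p s t : ℝ} (hp : 0 ≤ p) (hs : 0 ≤ s) (ht : 0 ≤ t) :
    (s + t) ^ p ≤ 2 ^ p * (s ^ p + t ^ p) := by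
  have h1 : s + t ≤ 2 * max s t := by
    linarith [le_max_left s t, le_max_right s t]
  have h2 : (max s t) ^ p ≤ s ^ p + t ^ p := by
    rcases max_cases s t with ⟨h, _⟩ | ⟨h, _⟩ <;> rw [h]
    · linarith [Real.rpow_nonneg ht p]
    · linarith [Real.rpow_nonneg hs p]
  calc (s + t) ^ p ≤ (2 * max s t) ^ p := Real.rpow_le_rpow (by positivity) h1 hp
    _ = 2 ^ p * (max s t) ^ p := Real.mul_rpow two_pos.le (by positivity)
    _ ≤ _ := by gcongr

omit [IsFiniteMeasure ν] in
-- By Tonelli the pointwise sum is integrable, hence almost everywhere finite, and it dominates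
-- every term. Fast convergence thus gives a majorant for the full sequence, with no passage to a
-- subsequence.
theorem exists_integrable_bound_of_summable {G : ℕ → α → ℝ} (hint : ∀ k, Integrable (G k) ν)
    (hnn : ∀ k, ∀ᵐ x ∂ν, 0 ≤ G k x) (hsum : Summable fun k => ∫ x, G k x ∂ν) :
    ∃ H : α → ℝ, Integrable H ν ∧ ∀ᵐ x ∂ν, Summable (fun k => G k x) ∧ ∀ k, G k x ≤ H x := by
  have hmeas : ∀ k, AEMeasurable (fun x => ENNReal.ofReal (G k x)) ν := fun k =>
    (hint k).1.aemeasurable.ennreal_ofReal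
  have hfin : ∫⁻ x, ∑' k, ENNReal.ofReal (G k x) ∂ν ≠ ⊤ := by
    rw [lintegral_tsum hmeas]
    simp_rw [fun k => (ofReal_integral_eq_lintegral_ofReal (hint k) (hnn k)).symm]
    exact hsum.tsum_ofReal_ne_top
  have hmeasS : AEMeasurable (fun x => ∑' k, ENNReal.ofReal (G k x)) ν :=
    AEMeasurable.tsum hmeas
  refine ⟨fun x => (∑' k, ENNReal.ofReal (G k x)).toReal,
    integrable_toReal_of_lintegral_ne_top hmeasS hfin, ?_⟩
  filter_upwards [ae_lt_top' hmeasS hfin, ae_all_iff.2 hnn] with x hx hx0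
  refine ⟨?_, fun k => ?_⟩
  · refine (ENNReal.summable_toReal hx.ne).congr fun k => ?_
    exact ENNReal.toReal_ofReal (hx0 k)
  · rw [← ENNReal.toReal_ofReal (hx0 k)]
    exact ENNReal.toReal_mono hx.ne (ENNReal.le_tsum k)

/-- Continuity of the superposition operator along sequences that converge fast in `L^p`. -/
theorem IsCoerciveField.tendsto_integral_inner {p μ lam : ℝ} {a : α → E → E}
    (ha : IsCoerciveField ν p μ lam a) {w : ℕ → α → E} {v : α → E}
    (hw : ∀ k, MemLp (w k) (expo p) ν) (hv : MemLp v (expo p) ν)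
    (hsum : Summable fun k => ∫ x, ‖w k x - v x‖ ^ p ∂ν)
    {ψ : α → E} (hψ : AEStronglyMeasurable ψ ν) {M : ℝ} (hM : ∀ x, ‖ψ x‖ ≤ M) :
    Tendsto (fun k => ∫ x, inner ℝ (a x (w k x)) (ψ x) ∂ν) atTop
      (𝓝 (∫ x, inner ℝ (a x (v x)) (ψ x) ∂ν)) := by
  have hp := ha.one_lt
  obtain ⟨c, hc0, hc⟩ := ha.growth
  have hint : ∀ k, Integrable (fun x => ‖w k x - v x‖ ^ p) ν := fun k =>
    integrable_norm_rpow_of_memLp hp ((hw k).sub hv)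
  obtain ⟨G, hG, hGw⟩ := exists_integrable_bound_of_summable hint
    (fun k => Eventually.of_forall fun x => by positivity) hsum
  refine tendsto_integral_of_dominated_convergence
    (fun x => c * (2 + 2 ^ p * (G x + ‖v x‖ ^ p)) * M)
    (fun k => (ha.memLp_comp (hw k)).1.inner hψ) ?_ ?_ ?_
  · exact (((integrable_const 2).add
      ((hG.add (integrable_norm_rpow_of_memLp hp hv)).const_mul _)).const_mul c).mul_const M
  · intro k
    filter_upwards [hc, hGw] with x hx hGx
    refine (norm_inner_le_norm _ _).trans ?_
    have h1 : ‖w k x‖ ≤ ‖w k x - v x‖ + ‖v x‖ := by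
      simpa using norm_add_le (w k x - v x) (v x)
    have h2 : ‖w k x‖ ^ p ≤ 2 ^ p * (G x + ‖v x‖ ^ p) :=
      (Real.rpow_le_rpow (norm_nonneg _) h1 (by linarith)).trans
        ((add_rpow_le (by linarith) (norm_nonneg _) (norm_nonneg _)).trans
          (by have := hGx.2 k; gcongr))
    have h3 : ‖w k x‖ ^ (p - 1) ≤ 1 + ‖w k x‖ ^ p := by
      rcases le_total ‖w k x‖ 1 with h | h
      · have := Real.rpow_le_one (norm_nonneg _) h (by linarith : 0 ≤ p - 1)
        have : 0 ≤ ‖w k x‖ ^ p := by positivity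
        linarith
      · have := Real.rpow_le_rpow_of_exponent_le h (by linarith : p - 1 ≤ p)
        linarith
    refine mul_le_mul ((hx _).trans ?_) (hM x) (norm_nonneg _) ?_
    · exact mul_le_mul_of_nonneg_left (by linarith) hc0.le
    · have := Real.rpow_nonneg (norm_nonneg (w k x)) p
      have : 0 ≤ 2 + 2 ^ p * (G x + ‖v x‖ ^ p) := by linarith
      positivity
  · filter_upwards [ha.ae_continuous, hGw] with x hx hGx
    refine Tendsto.inner ((hx.tendsto _).comp ?_) tendsto_const_nhds
    rw [tendsto_iff_norm_sub_tendsto_zero]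
    have h1 := (hGx.1.tendsto_atTop_zero).rpow_const (p := p⁻¹) (Or.inr (by positivity))
    rw [Real.zero_rpow (by positivity)] at h1
    refine h1.congr fun k => ?_
    rw [Real.rpow_rpow_inv (norm_nonneg _) (by linarith)]

end Fields

/-!
The iteration is the Bregman gradient (mirror descent) method for the energy of `a` with the
potential of `b` as reference function. The eigenvalue bounds say that this energy is smooth and
strongly convex relative to the reference function, which gives linear convergence with the step
size `1 / L` and no smallness condition on `l` and `L`.
-/

section MirrorDescent

variable {α : Type*} [MeasurableSpace α] {ν : Measure α} {E : Type*}
  [NormedAddCommGroup E] [InnerProductSpace ℝ E]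

/-- The energy `∫ P_a(x, v) - f · v`, where `P_a` is the potential of `a`. -/
noncomputable def energy (ν : Measure α) (a : α → E → E) (f v : α → E) : ℝ :=
  ∫ x, (segPotential (a x) (v x) - inner ℝ (f x) (v x)) ∂ν

variable [IsFiniteMeasure ν] [FiniteDimensional ℝ E]
  {p μ lam lam' l L : ℝ} {a b : α → E → E} {f : α → E}

/-- The term in `f` is affine, so the energy and the potential have the same Bregman distance. When
`w` solves the equation, the last integral vanishes for `v` in the same class. -/
theorem IsCoerciveField.integral_bregman_eq (ha : IsCoerciveField ν p μ lam a)
    (hf : MemLp f (conjExpo p) ν) {v w : α → E} (hv : MemLp v (expo p) ν)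
    (hw : MemLp w (expo p) ν) :
    ∫ x, bregman (a x) (v x) (w x) ∂ν = energy ν a f v - energy ν a f w
      - ∫ x, inner ℝ (a x (w x) - f x) (v x - w x) ∂ν := by
  have hp := ha.one_lt
  have hi : ∀ u : α → E, MemLp u (expo p) ν →
      Integrable (fun x => segPotential (a x) (u x) - inner ℝ (f x) (u x)) ν := fun u hu =>
    (ha.integrable_segPotential hu).sub (integrable_inner_of_memLp hp hf hu)
  have hi2 : Integrable (fun x => inner ℝ (a x (w x) - f x) (v x - w x)) ν :=
    integrable_inner_of_memLp hp ((ha.memLp_comp hw).sub hf) (hv.sub hw)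
  have hi3 : Integrable (fun x => segPotential (a x) (v x) - inner ℝ (f x) (v x)
      - (segPotential (a x) (w x) - inner ℝ (f x) (w x))) ν := (hi v hv).sub (hi w hw)
  rw [energy, energy, ← integral_sub (hi v hv) (hi w hw), ← integral_sub hi3 hi2]
  refine integral_congr_ae (Eventually.of_forall fun x => ?_)
  simp only [bregman, inner_sub_left, inner_sub_right]
  ring

/-- One step of the Bregman gradient method with relative smoothness constant `L` and relative
convexity constant `l`. -/
theorem IsCoerciveField.bregman_step (ha : IsCoerciveField ν p μ lam a)
    (hb : IsCoerciveField ν p μ lam' b) (hf : MemLp f (conjExpo p) ν) (hL : 0 < L)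
    (hlo : ∀ᵐ x ∂ν, ∀ z w, l * bregman (b x) z w ≤ bregman (a x) z w)
    (hup : ∀ᵐ x ∂ν, ∀ z w, bregman (a x) z w ≤ L * bregman (b x) z w)
    {v w w' : α → E} (hv : MemLp v (expo p) ν) (hw : MemLp w (expo p) ν)
    (hw' : MemLp w' (expo p) ν)
    (hstep : ∫ x, inner ℝ (b x (w' x) - (b x (w x) - L⁻¹ • a x (w x) + L⁻¹ • f x))
      (v x - w' x) ∂ν = 0) :
    L * ∫ x, bregman (b x) (v x) (w' x) ∂ν
      ≤ (L - l) * ∫ x, bregman (b x) (v x) (w x) ∂ν + (energy ν a f v - energy ν a f w') := by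
  have hp := ha.one_lt
  have hi : ∀ u : α → E, MemLp u (expo p) ν →
      Integrable (fun x => segPotential (a x) (u x) - inner ℝ (f x) (u x)) ν := fun u hu =>
    (ha.integrable_segPotential hu).sub (integrable_inner_of_memLp hp hf hu)
  have hi1 : Integrable (fun x => inner ℝ
      (b x (w' x) - (b x (w x) - L⁻¹ • a x (w x) + L⁻¹ • f x)) (v x - w' x)) ν :=
    integrable_inner_of_memLp hp ((hb.memLp_comp hw').sub (((hb.memLp_comp hw).sub
      ((ha.memLp_comp hw).const_smul _)).add (hf.const_smul _))) (hv.sub hw')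
  -- The step equation tested with `v - w'` adds zero, which reduces the claim to a pointwise
  -- inequality.
  have e : L * ∫ x, bregman (b x) (v x) (w' x) ∂ν
      = ∫ x, (L * bregman (b x) (v x) (w' x) + L * inner ℝ
      (b x (w' x) - (b x (w x) - L⁻¹ • a x (w x) + L⁻¹ • f x)) (v x - w' x)) ∂ν := by
    rw [integral_add ((hb.integrable_bregman hv hw').const_mul _) (hi1.const_mul _),
      integral_const_mul, integral_const_mul, hstep]
    ring
  have hi3 : Integrable (fun x => segPotential (a x) (v x) - inner ℝ (f x) (v x)
      - (segPotential (a x) (w' x) - inner ℝ (f x) (w' x))) ν := (hi v hv).sub (hi w' hw')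
  rw [e, energy, energy, ← integral_sub (hi v hv) (hi w' hw'), ← integral_const_mul,
    ← integral_add ((hb.integrable_bregman hv hw).const_mul _) hi3]
  refine integral_mono_ae
    (((hb.integrable_bregman hv hw').const_mul _).add (hi1.const_mul _))
    (((hb.integrable_bregman hv hw).const_mul _).add hi3) ?_
  -- Three-point identity for `D_b`, with the lower bound used at `(v, w)` and the upper bound at
  -- `(w', w)`; the terms `L D_b(w', w)` cancel.
  filter_upwards [hlo, hup] with x h1 h2
  have h1' := h1 (v x) (w x)
  have h2' := h2 (w' x) (w x)
  have e1 : L * inner ℝ (b x (w' x) - (b x (w x) - L⁻¹ • a x (w x) + L⁻¹ • f x)) (v x - w' x)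
      = L * inner ℝ (b x (w' x) - b x (w x)) (v x - w' x)
        + inner ℝ (a x (w x) - f x) (v x - w' x) := by
    have : b x (w' x) - (b x (w x) - L⁻¹ • a x (w x) + L⁻¹ • f x)
        = (b x (w' x) - b x (w x)) + L⁻¹ • (a x (w x) - f x) := by module
    rw [this, inner_add_left, real_inner_smul_left]
    field_simp
  rw [e1]
  simp only [bregman, inner_sub_left, inner_sub_right] at h1' h2' ⊢
  linarith

/-- The step inequality with the current iterate as competitor: `D_b(w, w) = 0`. -/
theorem energy_succ_le (ha : IsCoerciveField ν p μ lam a)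
    (hb : IsCoerciveField ν p μ lam' b) (hf : MemLp f (conjExpo p) ν) (hL : 0 < L)
    (hlo : ∀ᵐ x ∂ν, ∀ z w, l * bregman (b x) z w ≤ bregman (a x) z w)
    (hup : ∀ᵐ x ∂ν, ∀ z w, bregman (a x) z w ≤ L * bregman (b x) z w)
    {w w' : α → E} (hw : MemLp w (expo p) ν) (hw' : MemLp w' (expo p) ν)
    (hstep : ∫ x, inner ℝ (b x (w' x) - (b x (w x) - L⁻¹ • a x (w x) + L⁻¹ • f x))
      (w x - w' x) ∂ν = 0) :
    energy ν a f w' ≤ energy ν a f w := by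
  have h1 := ha.bregman_step hb hf hL hlo hup hw hw hw' hstep
  have h2 := hb.integral_bregman_nonneg w w'
  simp only [bregman_self, integral_zero, mul_zero, zero_add] at h1
  nlinarith

/-- Linear convergence, as long as the energy of the iterates stays above that of `v`. -/
theorem integral_rpow_le_of_iteration (E : Type*) [NormedAddCommGroup E]
    [InnerProductSpace ℝ E] [FiniteDimensional ℝ E] (hp : 1 < p) (hμ : 0 ≤ μ)
    (hlam : 0 < lam') (hl : 0 < l) (hlL : l ≤ L) :
    ∃ C : ℝ, 0 < C ∧ ∀ a b : α → E → E, ∀ f : α → E, IsCoerciveField ν p μ lam a →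
      IsCoerciveField ν p μ lam' b → MemLp f (conjExpo p) ν →
      (∀ᵐ x ∂ν, ∀ z w, l * bregman (b x) z w ≤ bregman (a x) z w) →
      (∀ᵐ x ∂ν, ∀ z w, bregman (a x) z w ≤ L * bregman (b x) z w) →
      ∀ (v : α → E) (w : ℕ → α → E), MemLp v (expo p) ν → (∀ k, MemLp (w k) (expo p) ν) →
      (∀ k, ∫ x, inner ℝ (b x (w (k + 1) x) - (b x (w k x) - L⁻¹ • a x (w k x) + L⁻¹ • f x))
        (v x - w (k + 1) x) ∂ν = 0) →
      ∀ k, (∀ j ≤ k, energy ν a f v ≤ energy ν a f (w j)) →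
        ∫ x, ‖v x - w k x‖ ^ p ∂ν
          ≤ (C * ∫ x, bregman (b x) (v x) (w 0 x) ∂ν + ∫ x, (μ + ‖v x‖) ^ p ∂ν)
            * √(1 - l / (2 * L)) ^ k := by
  obtain ⟨C, hC, hmain⟩ := IsCoerciveField.exists_integral_rpow_le (ν := ν) E hp hμ hlam
  refine ⟨C, hC, fun a b f ha hb hf hlo hup v w hv hw hstep k hk => ?_⟩
  have hL : 0 < L := hl.trans_le hlL
  -- The step gives the factor `1 - l/L`; halving `l` keeps `θ` positive even when `l = L`, as
  -- needed for dividing by a power of `√θ`.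
  set θ := 1 - l / (2 * L) with hθ
  have hθ0 : 0 < θ := by
    rw [hθ, sub_pos, div_lt_one (by positivity)]; linarith
  have hθ1 : θ ≤ 1 := by
    have : 0 ≤ l / (2 * L) := by positivity
    linarith
  have hD : ∀ j ≤ k, ∫ x, bregman (b x) (v x) (w j x) ∂ν
      ≤ θ ^ j * ∫ x, bregman (b x) (v x) (w 0 x) ∂ν := by
    intro j hj
    induction j with
    | zero => simp
    | succ j ih =>
      have h1 := ih (by omega)
      have h2 := ha.bregman_step hb hf hL hlo hup hv (hw j) (hw (j + 1)) (hstep j)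
      have h3 := hk (j + 1) hj
      have h4 := hb.integral_bregman_nonneg v (w j)
      have h5 : L * θ = L - l / 2 := by rw [hθ]; field_simp
      have h6 : L * ∫ x, bregman (b x) (v x) (w (j + 1) x) ∂ν
          ≤ L * (θ * ∫ x, bregman (b x) (v x) (w j x) ∂ν) := by
        rw [← mul_assoc, h5]
        nlinarith
      refine (le_of_mul_le_mul_left h6 hL).trans ?_
      rw [pow_succ', mul_assoc]
      gcongr
  -- With `η² = θ^k`, the Bregman term `θ^k / η` equals `η`, and the error term satisfies `η^p ≤ η`.
  set η := √θ ^ k with hη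
  have hs0 : 0 < √θ := Real.sqrt_pos.2 hθ0
  have hη0 : 0 < η := by positivity
  have hη1 : η ≤ 1 := pow_le_one₀ hs0.le (Real.sqrt_le_one.2 hθ1)
  have h1 := hmain b hb η hη0 hη1 v (w k) v hv (hw k) (Or.inl rfl)
  have h2 := hD k le_rfl
  have hηη : η * η = θ ^ k := by
    rw [hη, ← mul_pow, Real.mul_self_sqrt hθ0.le]
  rw [← hηη] at h2
  have h3 : C / η * ∫ x, bregman (b x) (v x) (w k x) ∂ν
      ≤ C / η * (η * η * ∫ x, bregman (b x) (v x) (w 0 x) ∂ν) := by gcongr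
  have h4 : C / η * (η * η * ∫ x, bregman (b x) (v x) (w 0 x) ∂ν)
      = C * (∫ x, bregman (b x) (v x) (w 0 x) ∂ν) * η := by field_simp
  have h5 : η ^ p ≤ η := by
    simpa using Real.rpow_le_rpow_of_exponent_ge hη0 hη1 hp.le
  have h6 : 0 ≤ ∫ x, (μ + ‖v x‖) ^ p ∂ν := integral_nonneg fun x => by positivity
  have h7 := mul_le_mul_of_nonneg_right h5 h6
  rw [add_mul]
  linarith

theorem le_of_rpow_le_mul {X N B : ℝ} (hp : 1 < p) (hX : 0 ≤ X) (hN : 0 ≤ N) (hB : 0 ≤ B)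
    (h : X ^ p ≤ N * X + B) : X ≤ 1 + (N + B) ^ (p - 1)⁻¹ := by
  rcases le_total X 1 with h1 | h1
  · have : 0 ≤ (N + B) ^ (p - 1)⁻¹ := by positivity
    linarith
  · have h2 : X ^ p = X ^ (p - 1) * X := by
      rw [← Real.rpow_add_one (by linarith)]; ring_nf
    have h3 : X ^ (p - 1) ≤ N + B := by
      have : X ^ (p - 1) * X ≤ (N + B) * X := by nlinarith
      exact le_of_mul_le_mul_right this (by linarith)
    have h4 := Real.rpow_le_rpow (by positivity) h3 (inv_nonneg.2 (by linarith : 0 ≤ p - 1))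
    rw [Real.rpow_rpow_inv hX (by linarith)] at h4
    linarith

/-- Sublevel sets of the energy are bounded. -/
theorem IsCoerciveField.exists_bound_of_energy_le (ha : IsCoerciveField ν p μ lam a)
    (hf : MemLp f (conjExpo p) ν) {w : α → E} (hw : MemLp w (expo p) ν) :
    ∃ K : ℝ, ∀ v : α → E, MemLp v (expo p) ν → energy ν a f v ≤ energy ν a f w →
      ∫ x, bregman (a x) (v x) (w x) ∂ν ≤ K ∧ ∫ x, (μ + ‖v x‖) ^ p ∂ν ≤ K := by
  have hp := ha.one_lt
  have hμ := ha.mu_nonneg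
  obtain ⟨C, hC, hmain⟩ :=
    IsCoerciveField.exists_integral_rpow_le (ν := ν) E hp hμ ha.lam_pos
  set N := (eLpNorm (fun x => a x (w x) - f x) (conjExpo p) ν).toReal with hN
  have hN0 : 0 ≤ N := ENNReal.toReal_nonneg
  -- Hölder bounds the Bregman distance by `N X` on the sublevel set. Coercivity with `η = 1` and
  -- error term at the fixed `w` gives `X^p ≤ C N X + B`, which bounds `X` because `p > 1`.
  set B := ∫ x, (μ + ‖w x‖) ^ p ∂ν with hB
  have hB0 : 0 ≤ B := integral_nonneg fun x => by positivity
  set X₀ := 1 + (C * N + B) ^ (p - 1)⁻¹ with hX₀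
  have hX₀0 : 0 ≤ X₀ := by positivity
  refine ⟨max (N * X₀) (2 ^ p * (B + X₀ ^ p)), fun v hv hle => ?_⟩
  set X := (eLpNorm (fun x => v x - w x) (expo p) ν).toReal with hX
  have hX0 : 0 ≤ X := ENNReal.toReal_nonneg
  have h1 : ∫ x, bregman (a x) (v x) (w x) ∂ν ≤ N * X := by
    have h2 := abs_integral_inner_le hp ((ha.memLp_comp hw).sub hf) (hv.sub hw)
    have h3 := ha.integral_bregman_eq hf hv hw
    have h4 := (abs_le.1 h2).1
    simp only [Pi.sub_apply] at h4
    change -(N * X) ≤ _ at h4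
    linarith
  have h2 := hmain a ha 1 one_pos le_rfl v w w hv hw (Or.inr rfl)
  have hXp : ∫ x, ‖v x - w x‖ ^ p ∂ν = X ^ p := integral_norm_rpow_eq hp (hv.sub hw)
  rw [hXp, div_one, Real.one_rpow, one_mul] at h2
  have hXX₀ : X ≤ X₀ := by
    refine le_of_rpow_le_mul hp hX0 (by positivity) hB0 (h2.trans ?_)
    nlinarith
  refine ⟨(h1.trans (by gcongr)).trans (le_max_left _ _), le_trans ?_ (le_max_right _ _)⟩
  have hi : Integrable (fun x => ‖v x - w x‖ ^ p) ν :=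
    integrable_norm_rpow_of_memLp hp (hv.sub hw)
  have h3 : ∫ x, (μ + ‖v x‖) ^ p ∂ν
      ≤ ∫ x, 2 ^ p * ((μ + ‖w x‖) ^ p + ‖v x - w x‖ ^ p) ∂ν := by
    refine integral_mono (ha.integrable_add_norm_rpow hv)
      (((ha.integrable_add_norm_rpow hw).add hi).const_mul _) fun x => ?_
    have h4 : μ + ‖v x‖ ≤ (μ + ‖w x‖) + ‖v x - w x‖ := by
      have : ‖v x‖ ≤ ‖w x‖ + ‖v x - w x‖ := by simpa using norm_add_le (w x) (v x - w x)
      linarith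
    exact (Real.rpow_le_rpow (by positivity) h4 (by linarith)).trans
      (add_rpow_le (by linarith) (by positivity) (norm_nonneg _))
  refine h3.trans ?_
  rw [integral_const_mul, integral_add (ha.integrable_add_norm_rpow hw) hi, hXp]
  gcongr

end MirrorDescent

/-! ### Test functions and their Poincaré inequality. -/

section TestFunctions

variable {N n : ℕ} {Ω : Set (Eu n)}

theorem IsTest.contDiff_one {F : Type} [NormedAddCommGroup F] [NormedSpace ℝ F]
    {φ : Eu n → F} (hφ : IsTest Ω φ) : ContDiff ℝ 1 φ := hφ.smooth.of_le (by norm_num)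

theorem IsTest.continuous_fderiv {F : Type} [NormedAddCommGroup F] [NormedSpace ℝ F]
    {φ : Eu n → F} (hφ : IsTest Ω φ) : Continuous (fderiv ℝ φ) :=
  hφ.contDiff_one.continuous_fderiv one_ne_zero

theorem IsTest.differentiable {F : Type} [NormedAddCommGroup F] [NormedSpace ℝ F]
    {φ : Eu n → F} (hφ : IsTest Ω φ) : Differentiable ℝ φ :=
  hφ.contDiff_one.differentiable one_ne_zero

theorem IsTest.sub {F : Type} [NormedAddCommGroup F] [NormedSpace ℝ F]
    {φ ψ : Eu n → F} (hφ : IsTest Ω φ) (hψ : IsTest Ω ψ) : IsTest Ω (fun x => φ x - ψ x) where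
  smooth := hφ.smooth.sub hψ.smooth
  compact := hφ.compact.sub hψ.compact
  subset := (tsupport_sub φ ψ).trans (Set.union_subset hφ.subset hψ.subset)

theorem isTest_zero {F : Type} [NormedAddCommGroup F] [NormedSpace ℝ F] :
    IsTest Ω (fun _ : Eu n => (0 : F)) where
  smooth := contDiff_const
  compact := HasCompactSupport.zero
  subset := by simp [tsupport]

theorem jac_zero : jac (fun _ : Eu n => (0 : Eu N)) = fun _ => 0 := by
  funext x
  ext ij
  simp [jac]

theorem IsTest.jac_sub {φ ψ : Eu n → Eu N} (hφ : IsTest Ω φ) (hψ : IsTest Ω ψ) (x : Eu n) :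
    jac (fun x => φ x - ψ x) x = jac φ x - jac ψ x := by
  ext ij
  simp [jac, fderiv_fun_sub (hφ.differentiable x) (hψ.differentiable x)]

theorem IsTest.continuous_jac {φ : Eu n → Eu N} (hφ : IsTest Ω φ) : Continuous (jac φ) := by
  have := hφ.continuous_fderiv
  unfold jac
  fun_prop

theorem IsTest.jac_eq_zero {φ : Eu n → Eu N} (_hφ : IsTest Ω φ) {x : Eu n}
    (hx : x ∉ tsupport φ) : jac φ x = 0 := by
  have h : fderiv ℝ φ x = 0 := by
    by_contra hne
    exact hx (support_fderiv_subset ℝ hne)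
  ext ij
  simp [jac, h]

theorem IsTest.hasCompactSupport_jac {φ : Eu n → Eu N} (hφ : IsTest Ω φ) :
    HasCompactSupport (jac φ) :=
  HasCompactSupport.intro hφ.compact fun _ hx => hφ.jac_eq_zero hx

theorem IsTest.exists_bound_jac {φ : Eu n → Eu N} (hφ : IsTest Ω φ) :
    ∃ M, ∀ x, ‖jac φ x‖ ≤ M := by
  obtain ⟨M, hM⟩ := hφ.continuous_jac.bounded_above_of_compact_support hφ.hasCompactSupport_jac
  exact ⟨M, hM⟩

theorem norm_fderiv_single_le_norm_jac (φ : Eu n → Eu N) (x : Eu n) (j : Fin n) :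
    ‖fderiv ℝ φ x (EuclideanSpace.single j (1 : ℝ))‖ ≤ ‖jac φ x‖ := by
  rw [EuclideanSpace.norm_eq, EuclideanSpace.norm_eq, Fintype.sum_prod_type]
  refine Real.sqrt_le_sqrt (Finset.sum_le_sum fun i _ => ?_)
  exact Finset.single_le_sum (f := fun j => ‖jac φ x (i, j)‖ ^ 2) (fun _ _ => by positivity)
    (Finset.mem_univ j)

/-- Poincaré's inequality for test functions. -/
theorem exists_eLpNorm_le_eLpNorm_jac (N : ℕ) (hn : 1 ≤ n) (hΩo : IsOpen Ω)
    (hΩ : Bornology.IsBounded Ω) {p : ℝ} (hp : 1 < p) :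
    ∃ K : ENNReal, K ≠ ⊤ ∧ ∀ φ : Eu n → Eu N, IsTest Ω φ →
      eLpNorm φ (expo p) (volume.restrict Ω) ≤ K * eLpNorm (jac φ) (expo p) (volume.restrict Ω) := by
  obtain ⟨r, hr⟩ := hΩ.subset_closedBall (0 : Eu n)
  -- Larger than the diameter of `Ω`: translation by `T e` leaves `Ω`, where test functions vanish.
  set T : ℝ := 2 * |r| + 1 with hT
  have hT0 : 0 < T := by positivity
  set e : Eu n := EuclideanSpace.single (⟨0, hn⟩ : Fin n) (1 : ℝ) with he
  have hout : ∀ x ∈ Ω, x + T • e ∉ Ω := by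
    intro x hx hx'
    have h1 := mem_closedBall_zero_iff.1 (hr hx)
    have h2 := mem_closedBall_zero_iff.1 (hr hx')
    have h3 : ‖T • e‖ = T := by
      rw [norm_smul, he, Real.norm_of_nonneg hT0.le]; simp
    have h4 : ‖T • e‖ ≤ ‖x + T • e‖ + ‖x‖ := by simpa using norm_sub_le (x + T • e) x
    have := le_abs_self r
    linarith
  have hconj := holderConjugate_of_one_lt hp
  set κ : ENNReal := (ENNReal.ofReal T ^ (1 / (p / (p - 1)))) ^ p * ENNReal.ofReal T with hκ
  have hκt : κ ≠ ⊤ := by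
    refine ENNReal.mul_ne_top (ENNReal.rpow_ne_top_of_nonneg (by linarith)
      (ENNReal.rpow_ne_top_of_nonneg ?_ ENNReal.ofReal_ne_top)) ENNReal.ofReal_ne_top
    exact one_div_nonneg.2 hconj.pos.le
  refine ⟨κ ^ (1 / p), ENNReal.rpow_ne_top_of_nonneg (by positivity) hκt, fun φ hφ => ?_⟩
  have hJ := hφ.continuous_jac
  -- Fundamental theorem of calculus from `x` to `x + T e`, then Hölder on `(0, T]`. Integration in
  -- `x` over the whole space then uses Tonelli and translation invariance.
  have hpt : ∀ x ∈ Ω, ‖φ x‖ₑ ^ p ≤ (ENNReal.ofReal T ^ (1 / (p / (p - 1)))) ^ p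
      * ∫⁻ t in Set.Ioc 0 T, ‖jac φ (x + t • e)‖ₑ ^ p := by
    intro x hx
    have h0 : φ (x + T • e) = 0 := by
      by_contra hne
      exact hout x hx (hφ.subset (subset_tsupport _ hne))
    have hder : ∀ t : ℝ, HasDerivAt (fun t : ℝ => φ (x + t • e)) (fderiv ℝ φ (x + t • e) e) t := by
      intro t
      have h1 : HasDerivAt (fun t : ℝ => x + t • e) e t := by
        simpa using ((hasDerivAt_id t).smul_const e).const_add x
      exact (hφ.differentiable (x + t • e)).hasFDerivAt.comp_hasDerivAt t h1
    have hcd : Continuous fun t : ℝ => fderiv ℝ φ (x + t • e) e :=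
      (hφ.continuous_fderiv.comp (by fun_prop)).clm_apply continuous_const
    have hint : ∫ t in (0 : ℝ)..T, fderiv ℝ φ (x + t • e) e = - φ x := by
      rw [intervalIntegral.integral_eq_sub_of_hasDerivAt (fun t _ => hder t)
        (hcd.intervalIntegrable _ _), h0]
      simp
    have h1 : ‖φ x‖ₑ ≤ ∫⁻ t in Set.Ioc 0 T, ‖jac φ (x + t • e)‖ₑ := by
      rw [← enorm_neg, ← hint, intervalIntegral.integral_of_le hT0.le]
      refine (enorm_integral_le_lintegral_enorm _).trans (lintegral_mono fun t => ?_)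
      exact enorm_le_iff_norm_le.2 (norm_fderiv_single_le_norm_jac φ _ _)
    have hm : Measurable fun t : ℝ => ‖jac φ (x + t • e)‖ₑ :=
      (hJ.comp (by fun_prop : Continuous fun t : ℝ => x + t • e)).enorm.measurable
    have h2 := ENNReal.lintegral_mul_le_Lp_mul_Lq (volume.restrict (Set.Ioc 0 T)) hconj
      (f := fun _ => 1) (g := fun t : ℝ => ‖jac φ (x + t • e)‖ₑ) aemeasurable_const hm.aemeasurable
    simp only [Pi.mul_apply, one_mul, ENNReal.one_rpow, lintegral_const,
      Measure.restrict_apply MeasurableSet.univ, Set.univ_inter, Real.volume_Ioc, sub_zero] at h2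
    have h3 := ENNReal.rpow_le_rpow (h1.trans h2) (by linarith : 0 ≤ p)
    rwa [ENNReal.mul_rpow_of_nonneg _ _ (by linarith : 0 ≤ p), ← ENNReal.rpow_mul _ (1 / p),
      one_div_mul_cancel (by linarith), ENNReal.rpow_one] at h3
  have hmeas : Measurable (Function.uncurry fun (x : Eu n) (t : ℝ) => ‖jac φ (x + t • e)‖ₑ ^ p) := by
    have : Continuous fun q : Eu n × ℝ => jac φ (q.1 + q.2 • e) := hJ.comp (by fun_prop)
    exact this.enorm.measurable.pow_const p
  have hmain : ∫⁻ x in Ω, ‖φ x‖ₑ ^ p ≤ κ * ∫⁻ x in Ω, ‖jac φ x‖ₑ ^ p := by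
    calc ∫⁻ x in Ω, ‖φ x‖ₑ ^ p
        ≤ ∫⁻ x in Ω, (ENNReal.ofReal T ^ (1 / (p / (p - 1)))) ^ p
            * ∫⁻ t in Set.Ioc 0 T, ‖jac φ (x + t • e)‖ₑ ^ p :=
          setLIntegral_mono' hΩo.measurableSet hpt
      _ ≤ ∫⁻ x, (ENNReal.ofReal T ^ (1 / (p / (p - 1)))) ^ p
            * ∫⁻ t in Set.Ioc 0 T, ‖jac φ (x + t • e)‖ₑ ^ p := setLIntegral_le_lintegral _ _
      _ = (ENNReal.ofReal T ^ (1 / (p / (p - 1)))) ^ p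
            * ∫⁻ x, ∫⁻ t in Set.Ioc 0 T, ‖jac φ (x + t • e)‖ₑ ^ p :=
          lintegral_const_mul _ hmeas.lintegral_prod_right'
      _ = (ENNReal.ofReal T ^ (1 / (p / (p - 1)))) ^ p
            * ∫⁻ t in Set.Ioc 0 T, ∫⁻ x, ‖jac φ (x + t • e)‖ₑ ^ p := by
          rw [lintegral_lintegral_swap hmeas.aemeasurable]
      _ = κ * ∫⁻ x, ‖jac φ x‖ₑ ^ p := by
          simp_rw [fun t : ℝ => lintegral_add_right_eq_self (μ := (volume : Measure (Eu n)))
            (fun x => ‖jac φ x‖ₑ ^ p) (t • e)]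
          rw [lintegral_const, Measure.restrict_apply MeasurableSet.univ, Set.univ_inter,
            Real.volume_Ioc, sub_zero, hκ]
          ring
      _ = κ * ∫⁻ x in Ω, ‖jac φ x‖ₑ ^ p := by
          congr 1
          rw [← lintegral_indicator hΩo.measurableSet]
          refine lintegral_congr fun x => ?_
          by_cases hx : x ∈ Ω
          · rw [Set.indicator_of_mem hx]
          · rw [Set.indicator_of_notMem hx,
              hφ.jac_eq_zero fun h => hx (hφ.subset h), enorm_zero,
              ENNReal.zero_rpow_of_pos (by linarith)]
  rw [eLpNorm_eq_lintegral_rpow_enorm_toReal (expo_ne_zero hp) ENNReal.ofReal_ne_top,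
    eLpNorm_eq_lintegral_rpow_enorm_toReal (expo_ne_zero hp) ENNReal.ofReal_ne_top,
    toReal_expo hp, ← ENNReal.mul_rpow_of_nonneg _ _ (by positivity)]
  exact ENNReal.rpow_le_rpow hmain (by positivity)

end TestFunctions

/-! ### The class `g + W^{1,p}_0`: Poincaré inequality, testing, closedness and completeness. -/

section SobolevClass

variable {N n : ℕ} {Ω : Set (Eu n)} {p : ℝ}

theorem toReal_eLpNorm_mono {α E E' : Type*} [MeasurableSpace α] {ν : Measure α}
    [NormedAddCommGroup E] [NormedAddCommGroup E'] {q : ENNReal} {v : α → E} {w : α → E'}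
    (hw : MemLp w q ν) {c : ENNReal} (hc : c ≠ ⊤)
    (h : eLpNorm v q ν ≤ c * eLpNorm w q ν) :
    (eLpNorm v q ν).toReal ≤ c.toReal * (eLpNorm w q ν).toReal := by
  rw [← ENNReal.toReal_mul]
  exact ENNReal.toReal_mono (ENNReal.mul_ne_top hc hw.2.ne) h

theorem W1p.inClass_self (g : W1p N Ω p) : g.InClass g := by
  intro ε hε
  refine ⟨fun _ => 0, isTest_zero, ?_, ?_⟩
  · simp
  · simp [jac_zero]

theorem IsTest.memLp {φ : Eu n → Eu N} (hφ : IsTest Ω φ) (q : ENNReal) :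
    MemLp φ q (volume.restrict Ω) :=
  (hφ.smooth.continuous.memLp_of_hasCompactSupport hφ.compact).restrict Ω

theorem IsTest.memLp_jac {φ : Eu n → Eu N} (hφ : IsTest Ω φ) (q : ENNReal) :
    MemLp (jac φ) q (volume.restrict Ω) :=
  (hφ.continuous_jac.memLp_of_hasCompactSupport hφ.hasCompactSupport_jac).restrict Ω

/-- The datum `g` cancels, so differences within the class lie in `W^{1,p}_0`. -/
theorem W1p.InClass.exists_test_sub (hp : 1 < p) {u v g : W1p N Ω p} (hu : u.InClass g)
    (hv : v.InClass g) {ε : ℝ} (hε : 0 < ε) : ∃ φ : Eu n → Eu N, IsTest Ω φ ∧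
      eLpNorm (fun x => u.toFun x - v.toFun x - φ x) (expo p) (volume.restrict Ω)
        ≤ ENNReal.ofReal ε ∧
      eLpNorm (fun x => u.grad x - v.grad x - jac φ x) (expo p) (volume.restrict Ω)
        ≤ ENNReal.ofReal ε := by
  obtain ⟨φ, hφ, h1, h2⟩ := hu (ε / 2) (half_pos hε)
  obtain ⟨ψ, hψ, h3, h4⟩ := hv (ε / 2) (half_pos hε)
  have hε2 : ENNReal.ofReal (ε / 2) + ENNReal.ofReal (ε / 2) = ENNReal.ofReal ε := by
    rw [← ENNReal.ofReal_add (by positivity) (by positivity), add_halves]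
  refine ⟨_, hφ.sub hψ, ?_, ?_⟩
  · have e : (fun x => u.toFun x - v.toFun x - (φ x - ψ x))
        = (fun x => u.toFun x - g.toFun x - φ x) - fun x => v.toFun x - g.toFun x - ψ x := by
      funext x; simp only [Pi.sub_apply]; abel
    rw [e, ← hε2]
    exact (eLpNorm_sub_le ((u.memLp.sub g.memLp).sub (hφ.memLp _)).1
      ((v.memLp.sub g.memLp).sub (hψ.memLp _)).1 (one_le_expo hp)).trans (add_le_add h1 h3)
  · have e : (fun x => u.grad x - v.grad x - jac (fun x => φ x - ψ x) x)
        = (fun x => u.grad x - g.grad x - jac φ x) - fun x => v.grad x - g.grad x - jac ψ x := by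
      funext x; simp only [Pi.sub_apply, hφ.jac_sub hψ]; abel
    rw [e, ← hε2]
    exact (eLpNorm_sub_le ((u.memLp_grad.sub g.memLp_grad).sub (hφ.memLp_jac _)).1
      ((v.memLp_grad.sub g.memLp_grad).sub (hψ.memLp_jac _)).1 (one_le_expo hp)).trans
      (add_le_add h2 h4)

/-- Poincaré's inequality on `W^{1,p}_0`. -/
theorem exists_eLpNorm_sub_le (N : ℕ) (hn : 1 ≤ n) (hΩo : IsOpen Ω)
    (hΩ : Bornology.IsBounded Ω) (hp : 1 < p) :
    ∃ K : ENNReal, K ≠ ⊤ ∧ ∀ u v g : W1p N Ω p, u.InClass g → v.InClass g →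
      eLpNorm (fun x => u.toFun x - v.toFun x) (expo p) (volume.restrict Ω)
        ≤ K * eLpNorm (fun x => u.grad x - v.grad x) (expo p) (volume.restrict Ω) := by
  obtain ⟨K, hK, h⟩ := exists_eLpNorm_le_eLpNorm_jac N hn hΩo hΩ hp
  refine ⟨K, hK, fun u v g hu hv => ?_⟩
  set X := eLpNorm (fun x => u.grad x - v.grad x) (expo p) (volume.restrict Ω) with hX
  have hle : ∀ ε : ℝ, 0 < ε →
      eLpNorm (fun x => u.toFun x - v.toFun x) (expo p) (volume.restrict Ω)
        ≤ ENNReal.ofReal ε + K * (X + ENNReal.ofReal ε) := by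
    intro ε hε
    obtain ⟨φ, hφ, h1, h2⟩ := hu.exists_test_sub hp hv hε
    have e1 : (fun x => u.toFun x - v.toFun x)
        = (fun x => u.toFun x - v.toFun x - φ x) + φ := by
      funext x; simp
    have e2 : jac φ = (fun x => u.grad x - v.grad x)
        - (fun x => u.grad x - v.grad x - jac φ x) := by
      funext x; simp
    have h3 : eLpNorm (jac φ) (expo p) (volume.restrict Ω) ≤ X + ENNReal.ofReal ε := by
      rw [e2]
      exact (eLpNorm_sub_le (u.memLp_grad.sub v.memLp_grad).1
        ((u.memLp_grad.sub v.memLp_grad).sub (hφ.memLp_jac _)).1 (one_le_expo hp)).trans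
        (add_le_add le_rfl h2)
    rw [e1]
    refine (eLpNorm_add_le ((u.memLp.sub v.memLp).sub (hφ.memLp _)).1 (hφ.memLp (expo p)).1
      (one_le_expo hp)).trans (add_le_add h1 ((h φ hφ).trans ?_))
    gcongr
  have h0 : Tendsto (fun ε : ℝ => ENNReal.ofReal ε) (𝓝[>] 0) (𝓝 0) := by
    have := (ENNReal.continuous_ofReal.tendsto 0).mono_left
      (nhdsWithin_le_nhds (s := Set.Ioi (0 : ℝ)))
    rwa [ENNReal.ofReal_zero] at this
  have hlim : Tendsto (fun ε : ℝ => ENNReal.ofReal ε + K * (X + ENNReal.ofReal ε)) (𝓝[>] 0)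
      (𝓝 (0 + K * (X + 0))) :=
    h0.add (ENNReal.Tendsto.const_mul (tendsto_const_nhds.add h0) (Or.inr hK))
  rw [zero_add, add_zero] at hlim
  exact ge_of_tendsto hlim (by filter_upwards [self_mem_nhdsWithin] with ε hε using hle ε hε)

/-- Differences of elements of `W^{1,p}_g` are admissible test functions. -/
theorem integral_inner_grad_sub_eq_zero (hp : 1 < p) {F : Eu n → Mat N n}
    (hF : MemLp F (conjExpo p) (volume.restrict Ω))
    (h0 : ∀ φ : Eu n → Eu N, IsTest Ω φ → ∫ x in Ω, inner ℝ (F x) (jac φ x) = 0)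
    {u v g : W1p N Ω p} (hu : u.InClass g) (hv : v.InClass g) :
    ∫ x in Ω, inner ℝ (F x) (u.grad x - v.grad x) = 0 := by
  set A := (eLpNorm F (conjExpo p) (volume.restrict Ω)).toReal with hA
  have hle : ∀ ε : ℝ, 0 < ε → |∫ x in Ω, inner ℝ (F x) (u.grad x - v.grad x)| ≤ A * ε := by
    intro ε hε
    obtain ⟨φ, hφ, -, h2⟩ := hu.exists_test_sub hp hv hε
    have hd : MemLp (fun x => u.grad x - v.grad x) (expo p) (volume.restrict Ω) :=
      u.memLp_grad.sub v.memLp_grad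
    have e : ∫ x in Ω, inner ℝ (F x) (u.grad x - v.grad x)
        = ∫ x in Ω, inner ℝ (F x) (u.grad x - v.grad x - jac φ x) := by
      simp_rw [inner_sub_right (𝕜 := ℝ) _ _ (jac φ _)]
      rw [integral_sub (integrable_inner_of_memLp hp hF hd)
        (integrable_inner_of_memLp hp hF (hφ.memLp_jac _)), h0 φ hφ, sub_zero]
    rw [e]
    refine (abs_integral_inner_le hp hF (hd.sub (hφ.memLp_jac _))).trans ?_
    refine mul_le_mul_of_nonneg_left ?_ ENNReal.toReal_nonneg
    exact ENNReal.toReal_le_of_le_ofReal hε.le h2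
  have hlim : Tendsto (fun ε : ℝ => A * ε) (𝓝[>] 0) (𝓝 0) := by
    have : Tendsto (fun ε : ℝ => A * ε) (𝓝 0) (𝓝 (A * 0)) :=
      (continuous_const.mul continuous_id).tendsto 0
    rw [mul_zero] at this
    exact this.mono_left nhdsWithin_le_nhds
  exact abs_nonpos_iff.1 (ge_of_tendsto hlim
    (by filter_upwards [self_mem_nhdsWithin] with ε hε using hle ε hε))

theorem tendsto_integral_inner_of_eLpNorm {α E : Type*} [MeasurableSpace α] {ν : Measure α}
    [NormedAddCommGroup E] [InnerProductSpace ℝ E] (hp : 1 < p) {F : α → E}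
    (hF : MemLp F (conjExpo p) ν) {w : ℕ → α → E} {v : α → E} (hw : ∀ k, MemLp (w k) (expo p) ν)
    (hv : MemLp v (expo p) ν)
    (h : Tendsto (fun k => eLpNorm (w k - v) (expo p) ν) atTop (𝓝 0)) :
    Tendsto (fun k => ∫ x, inner ℝ (F x) (w k x) ∂ν) atTop (𝓝 (∫ x, inner ℝ (F x) (v x) ∂ν)) := by
  rw [tendsto_iff_norm_sub_tendsto_zero]
  have h1 : Tendsto (fun k => (eLpNorm F (conjExpo p) ν).toReal
      * (eLpNorm (w k - v) (expo p) ν).toReal) atTop (𝓝 0) := by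
    have := ((ENNReal.tendsto_toReal ENNReal.zero_ne_top).comp h).const_mul
      (eLpNorm F (conjExpo p) ν).toReal
    simpa using this
  refine squeeze_zero (fun _ => norm_nonneg _) (fun k => ?_) h1
  rw [← integral_sub (integrable_inner_of_memLp hp hF (hw k))
    (integrable_inner_of_memLp hp hF hv)]
  simp_rw [← inner_sub_right]
  exact abs_integral_inner_le hp hF ((hw k).sub hv)

theorem HasWeakJac.of_tendsto (hp : 1 < p) {w : ℕ → W1p N Ω p} {U : Eu n → Eu N}
    {G : Eu n → Mat N n} (hU : MemLp U (expo p) (volume.restrict Ω))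
    (hG : MemLp G (expo p) (volume.restrict Ω))
    (h1 : Tendsto (fun k => eLpNorm ((w k).toFun - U) (expo p) (volume.restrict Ω)) atTop (𝓝 0))
    (h2 : Tendsto (fun k => eLpNorm ((w k).grad - G) (expo p) (volume.restrict Ω)) atTop (𝓝 0)) :
    HasWeakJac Ω U G := by
  intro φ hφ i j
  -- Each coordinate is written as an inner product with a multiple of a basis vector, so that the
  -- vector-valued Hölder pairing passes to the limit in both sides.
  have key : ∀ {ι : Type} [Fintype ι] [DecidableEq ι] (ψ : Eu n → ℝ), Continuous ψ →
      HasCompactSupport ψ → ∀ i : ι,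
      MemLp (fun x => EuclideanSpace.single i (ψ x)) (conjExpo p) (volume.restrict Ω) := by
    intro ι _ _ ψ hψ hψc i
    refine Continuous.memLp_of_hasCompactSupport ?_ ?_ |>.restrict Ω
    · refine (hψ.smul (continuous_const (y := EuclideanSpace.single i (1 : ℝ)))).congr fun x => ?_
      ext k
      simp
    · exact hψc.comp_left (g := fun t : ℝ => EuclideanSpace.single i t) (by simp)
  have hφ' := hφ.continuous_fderiv.clm_apply (continuous_const (y := EuclideanSpace.single j (1 : ℝ)))
  have hφc : HasCompactSupport fun x => fderiv ℝ φ x (EuclideanSpace.single j (1 : ℝ)) :=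
    hφ.compact.fderiv_apply ℝ _
  have t1 := tendsto_integral_inner_of_eLpNorm hp (key _ hφ' hφc i) (fun k => (w k).memLp) hU h1
  have t2 := tendsto_integral_inner_of_eLpNorm hp (key φ hφ.smooth.continuous hφ.compact (i, j))
    (fun k => (w k).memLp_grad) hG h2
  simp only [EuclideanSpace.inner_single_left, conj_trivial] at t1 t2
  have e : ∀ k, ∫ x in Ω, fderiv ℝ φ x (EuclideanSpace.single j (1 : ℝ)) * (w k).toFun x i
      = - ∫ x in Ω, φ x * (w k).grad x (i, j) := by
    intro k
    have := (w k).hasWeakJac φ hφ i j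
    simp_rw [mul_comm (φ _), mul_comm (fderiv ℝ φ _ _)]
    exact this
  simp_rw [e] at t1
  have := tendsto_nhds_unique t1 t2.neg
  simp_rw [mul_comm (U _ _), mul_comm (G _ _)]
  exact this

theorem W1p.InClass.of_tendsto (hp : 1 < p) {w : ℕ → W1p N Ω p} {u g : W1p N Ω p}
    (hw : ∀ k, (w k).InClass g)
    (h1 : Tendsto (fun k => eLpNorm ((w k).toFun - u.toFun) (expo p) (volume.restrict Ω))
      atTop (𝓝 0))
    (h2 : Tendsto (fun k => eLpNorm ((w k).grad - u.grad) (expo p) (volume.restrict Ω))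
      atTop (𝓝 0)) : u.InClass g := by
  intro ε hε
  have hpos : 0 < ENNReal.ofReal (ε / 2) := ENNReal.ofReal_pos.2 (half_pos hε)
  obtain ⟨k, hk1, hk2⟩ := ((h1.eventually (gt_mem_nhds hpos)).and
    (h2.eventually (gt_mem_nhds hpos))).exists
  obtain ⟨φ, hφ, h3, h4⟩ := hw k (ε / 2) (half_pos hε)
  have hε2 : ENNReal.ofReal (ε / 2) + ENNReal.ofReal (ε / 2) = ENNReal.ofReal ε := by
    rw [← ENNReal.ofReal_add (by positivity) (by positivity), add_halves]
  refine ⟨φ, hφ, ?_, ?_⟩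
  · have e : (fun x => u.toFun x - g.toFun x - φ x)
        = (fun x => (w k).toFun x - g.toFun x - φ x) - ((w k).toFun - u.toFun) := by
      funext x; simp only [Pi.sub_apply]; abel
    rw [e, ← hε2]
    exact (eLpNorm_sub_le (((w k).memLp.sub g.memLp).sub (hφ.memLp _)).1
      ((w k).memLp.sub u.memLp).1 (one_le_expo hp)).trans (add_le_add h3 hk1.le)
  · have e : (fun x => u.grad x - g.grad x - jac φ x)
        = (fun x => (w k).grad x - g.grad x - jac φ x) - ((w k).grad - u.grad) := by
      funext x; simp only [Pi.sub_apply]; abel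
    rw [e, ← hε2]
    exact (eLpNorm_sub_le (((w k).memLp_grad.sub g.memLp_grad).sub (hφ.memLp_jac _)).1
      ((w k).memLp_grad.sub u.memLp_grad).1 (one_le_expo hp)).trans (add_le_add h4 hk2.le)

/-- Completeness of `W^{1,p}` for sequences with a linear Cauchy rate. -/
theorem W1p.exists_limit (hp : 1 < p) {w : ℕ → W1p N Ω p} {C R : ℝ} (hC : 0 ≤ C) (hR0 : 0 < R)
    (hR1 : R < 1) (h : ∀ k m, k ≤ m → (w k).gap (w m) ≤ C * R ^ k) :
    ∃ u : W1p N Ω p,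
      Tendsto (fun k => eLpNorm ((w k).toFun - u.toFun) (expo p) (volume.restrict Ω))
        atTop (𝓝 0) ∧
      Tendsto (fun k => eLpNorm ((w k).grad - u.grad) (expo p) (volume.restrict Ω))
        atTop (𝓝 0) := by
  -- `C + 1` makes the Cauchy bound strict, also when `C = 0`.
  have hB : ∑' k, ENNReal.ofReal ((C + 1) * R ^ k) ≠ ⊤ :=
    ((summable_geometric_of_lt_one hR0.le hR1).mul_left (C + 1)).tsum_ofReal_ne_top
  have cauchy : ∀ {E : Type} [NormedAddCommGroup E] [CompleteSpace E] (f : ℕ → Eu n → E),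
      (∀ k, MemLp (f k) (expo p) (volume.restrict Ω)) →
      (∀ k m, k ≤ m → (eLpNorm (f k - f m) (expo p) (volume.restrict Ω)).toReal ≤ C * R ^ k) →
      ∃ F, MemLp F (expo p) (volume.restrict Ω) ∧
        Tendsto (fun k => eLpNorm (f k - F) (expo p) (volume.restrict Ω)) atTop (𝓝 0) := by
    intro E _ _ f hf hfc
    have aux : ∀ K k m, K ≤ k → k ≤ m →
        eLpNorm (f k - f m) (expo p) (volume.restrict Ω) < ENNReal.ofReal ((C + 1) * R ^ K) := by
      intro K k m hK hkm
      rw [← ENNReal.ofReal_toReal ((hf k).sub (hf m)).2.ne]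
      refine (ENNReal.ofReal_lt_ofReal_iff (by positivity)).2 ((hfc k m hkm).trans_lt ?_)
      have h1 : R ^ k ≤ R ^ K := pow_le_pow_of_le_one hR0.le hR1.le hK
      have h2 : 0 < R ^ K := by positivity
      nlinarith
    refine Lp.cauchy_complete_eLpNorm (one_le_expo hp) hf hB fun K k m hk hm => ?_
    rcases le_total k m with hkm | hkm
    · exact aux K k m hk hkm
    · rw [eLpNorm_sub_comm]
      exact aux K m k hm hkm
  obtain ⟨U, hU, tU⟩ := cauchy (fun k => (w k).toFun) (fun k => (w k).memLp) fun k m hkm =>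
    le_trans (le_add_of_nonneg_right ENNReal.toReal_nonneg) (h k m hkm)
  obtain ⟨G, hG, tG⟩ := cauchy (fun k => (w k).grad) (fun k => (w k).memLp_grad) fun k m hkm =>
    le_trans (le_add_of_nonneg_left ENNReal.toReal_nonneg) (h k m hkm)
  exact ⟨⟨U, G, hU, hG, HasWeakJac.of_tendsto hp hU hG tU tG⟩, tU, tG⟩

end SobolevClass

/-! ### From the structure conditions to Bregman bounds and to testing with Sobolev functions. -/

section EllipticFields

variable {N n : ℕ} {Ω : Set (Eu n)} {p μ : ℝ}

/-- Off the origin the weight is finite for all `p` and `μ`, so the singular and regular cases are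
treated alike from here on. -/
theorem IsEllipticField.isCoerciveField {lam Lam : ℝ} {a : Eu n → Mat N n → Mat N n}
    (ha : IsEllipticField Ω p μ lam Lam a) (hΩ : IsOpen Ω) (hp : 1 < p) :
    IsCoerciveField (volume.restrict Ω) p μ lam a := by
  have hsub : ∀ z : Mat N n, z ≠ 0 → z ∈ finiteWeight N n p μ := fun z hz => by
    right
    have := norm_pos_iff.2 hz
    positivity
  refine ⟨hp, ha.mu_nonneg, ha.lam_pos, ha.measurable, ?_, ?_, ?_⟩
  · filter_upwards [ha.continuous, ha.contDiffOn, ha.symmetric] with x h1 h2 h3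
    refine ⟨h1, fun z hz => ?_, fun z hz => h3 z (hsub z hz)⟩
    have h4 : ContDiffOn ℝ 1 (a x) {0}ᶜ := h2.mono fun z hz => hsub z hz
    exact (h4.contDiffAt (isOpen_compl_singleton.mem_nhds hz)).differentiableAt one_ne_zero
  · filter_upwards [ha.elliptic] with x hx z hz ξ using (hx z (hsub z hz) ξ).1
  · obtain ⟨c, hc0, hc⟩ := ha.growth
    refine ⟨c, hc0, ?_⟩
    filter_upwards [ae_restrict_mem hΩ.measurableSet] with x hx using hc x hx

theorem EigenvalueBounds.bregman_bounds {lam_a Lam_a lam_b Lam_b l L : ℝ}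
    {a b : Eu n → Mat N n → Mat N n} (hΩ : IsOpen Ω) (hp : 1 < p)
    (ha : IsEllipticField Ω p μ lam_a Lam_a a) (hb : IsEllipticField Ω p μ lam_b Lam_b b)
    (hab : EigenvalueBounds Ω p μ a b l L) :
    (∀ᵐ x ∂(volume.restrict Ω), ∀ z w, l * bregman (b x) z w ≤ bregman (a x) z w) ∧
    ∀ᵐ x ∂(volume.restrict Ω), ∀ z w, bregman (a x) z w ≤ L * bregman (b x) z w := by
  have hca := ha.isCoerciveField hΩ hp
  have hcb := hb.isCoerciveField hΩ hp
  have key : ∀ᵐ x ∂(volume.restrict Ω), ∀ z : Mat N n, z ≠ 0 → ∀ ξ : Mat N n,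
      l * inner ℝ (fderiv ℝ (b x) z ξ) ξ ≤ inner ℝ (fderiv ℝ (a x) z ξ) ξ ∧
      inner ℝ (fderiv ℝ (a x) z ξ) ξ ≤ L * inner ℝ (fderiv ℝ (b x) z ξ) ξ := by
    filter_upwards [hab, hca.gradient, hcb.gradient, hcb.elliptic] with x hx h1 h2 h3 z hz ξ
    have hn := norm_pos_iff.2 hz
    refine inner_bounds_of_eigenvalue_bounds (h1.symmetric z hz) (h2.symmetric z hz) ?_
      (hx z (Or.inr (by positivity))) ξ
    intro η hη
    refine lt_of_lt_of_le ?_ (h3 z hz η)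
    have := norm_pos_iff.2 hη
    have := hb.lam_pos
    positivity
  constructor
  · filter_upwards [key, hca.gradient, hcb.gradient] with x hx h1 h2 z w
    have := h1.bregman_comb_nonneg h2 (α := 1) (β := -l)
      (fun y hy ξ => by linarith [(hx y hy ξ).1]) z w
    linarith
  · filter_upwards [key, hca.gradient, hcb.gradient] with x hx h1 h2 z w
    have := h1.bregman_comb_nonneg h2 (α := -1) (β := L)
      (fun y hy ξ => by linarith [(hx y hy ξ).2]) z w
    linarith

theorem SolvesIn.integral_eq_zero [IsFiniteMeasure (volume.restrict Ω)]
    {a : Eu n → Mat N n → Mat N n} {lam : ℝ}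
    (ha : IsCoerciveField (volume.restrict Ω) p μ lam a) {F : Eu n → Mat N n}
    (hF : MemLp F (conjExpo p) (volume.restrict Ω)) {g u : W1p N Ω p} (hu : SolvesIn a g F u)
    {v v' : W1p N Ω p} (hv : v.InClass g) (hv' : v'.InClass g) :
    ∫ x in Ω, inner ℝ (a x (u.grad x) - F x) (v.grad x - v'.grad x) = 0 := by
  refine integral_inner_grad_sub_eq_zero ha.one_lt ((ha.memLp_comp u.memLp_grad).sub hF) ?_ hv hv'
  intro φ hφ
  simp only [inner_sub_left, Pi.sub_apply]
  rw [integral_sub (integrable_inner_of_memLp ha.one_lt (ha.memLp_comp u.memLp_grad)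
    (hφ.memLp_jac _)) (integrable_inner_of_memLp ha.one_lt hF (hφ.memLp_jac _)), hu.2 φ hφ,
    sub_self]

end EllipticFields

/-! ### Existence of iterations and monotonicity of their energy. -/

section Iteration

variable {N n : ℕ} {Ω : Set (Eu n)} {p μ lam lam' l L : ℝ} {a b : Eu n → Mat N n → Mat N n}
  {f : Eu n → Mat N n} {g : W1p N Ω p}

theorem IsKoshelevIteration.inClass {γ : ℝ} {w : ℕ → W1p N Ω p}
    (hw : IsKoshelevIteration a b g f γ w) (k : ℕ) : (w k).InClass g := by
  cases k with
  | zero => exact hw.1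
  | succ k => exact (hw.2 k).1

variable [IsFiniteMeasure (volume.restrict Ω)]

theorem memLp_iteration_rhs (ha : IsCoerciveField (volume.restrict Ω) p μ lam a)
    (hb : IsCoerciveField (volume.restrict Ω) p μ lam' b)
    (hf : MemLp f (conjExpo p) (volume.restrict Ω)) (γ : ℝ) (u : W1p N Ω p) :
    MemLp (fun x => b x (u.grad x) - γ • a x (u.grad x) + γ • f x) (conjExpo p)
      (volume.restrict Ω) :=
  ((hb.memLp_comp u.memLp_grad).sub ((ha.memLp_comp u.memLp_grad).const_smul γ)).add
    (hf.const_smul γ)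

theorem IsKoshelevIteration.integral_step {γ : ℝ} {w : ℕ → W1p N Ω p}
    (ha : IsCoerciveField (volume.restrict Ω) p μ lam a)
    (hb : IsCoerciveField (volume.restrict Ω) p μ lam' b)
    (hf : MemLp f (conjExpo p) (volume.restrict Ω))
    (hw : IsKoshelevIteration a b g f γ w) {v : W1p N Ω p} (hv : v.InClass g) (k : ℕ) :
    ∫ x in Ω, inner ℝ (b x ((w (k + 1)).grad x)
      - (b x ((w k).grad x) - γ • a x ((w k).grad x) + γ • f x))
      (v.grad x - (w (k + 1)).grad x) = 0 :=
  (hw.2 k).integral_eq_zero hb (memLp_iteration_rhs ha hb hf γ (w k)) hv (hw.inClass _)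

theorem exists_iteration (ha : IsCoerciveField (volume.restrict Ω) p μ lam a)
    (hb : IsCoerciveField (volume.restrict Ω) p μ lam' b)
    (hf : MemLp f (conjExpo p) (volume.restrict Ω))
    (hsolv : ∀ F : Eu n → Mat N n, MemLp F (conjExpo p) (volume.restrict Ω) →
      UniquelySolvable b g F) (γ : ℝ) {u₀ : W1p N Ω p} (hu₀ : u₀.InClass g) :
    ∃ w : ℕ → W1p N Ω p, w 0 = u₀ ∧ IsKoshelevIteration a b g f γ w := by
  choose next hnext _ using fun u : W1p N Ω p => hsolv _ (memLp_iteration_rhs ha hb hf γ u)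
  refine ⟨fun k => next^[k] u₀, rfl, hu₀, fun k => ?_⟩
  simp only [Function.iterate_succ_apply']
  exact hnext (next^[k] u₀)

/-- This makes every later iterate an admissible competitor for all earlier steps. -/
theorem IsKoshelevIteration.energy_antitone {w : ℕ → W1p N Ω p}
    (ha : IsCoerciveField (volume.restrict Ω) p μ lam a)
    (hb : IsCoerciveField (volume.restrict Ω) p μ lam' b)
    (hf : MemLp f (conjExpo p) (volume.restrict Ω)) (hL : 0 < L)
    (hlo : ∀ᵐ x ∂(volume.restrict Ω), ∀ z w, l * bregman (b x) z w ≤ bregman (a x) z w)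
    (hup : ∀ᵐ x ∂(volume.restrict Ω), ∀ z w, bregman (a x) z w ≤ L * bregman (b x) z w)
    (hw : IsKoshelevIteration a b g f L⁻¹ w) :
    Antitone fun k => energy (volume.restrict Ω) a f (w k).grad :=
  antitone_nat_of_succ_le fun k => energy_succ_le ha hb hf hL hlo hup (w k).memLp_grad
    (w (k + 1)).memLp_grad (hw.integral_step ha hb hf (hw.inClass k) k)

/-- The energy gap to a solution equals an integrated Bregman distance, which is nonnegative. -/
theorem SolvesIn.energy_le (ha : IsCoerciveField (volume.restrict Ω) p μ lam a)
    (hf : MemLp f (conjExpo p) (volume.restrict Ω)) {u v : W1p N Ω p} (hu : SolvesIn a g f u)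
    (hv : v.InClass g) :
    energy (volume.restrict Ω) a f u.grad ≤ energy (volume.restrict Ω) a f v.grad := by
  have h1 := ha.integral_bregman_eq hf v.memLp_grad u.memLp_grad
  rw [hu.integral_eq_zero ha hf hv hu.1, sub_zero] at h1
  have h2 := ha.integral_bregman_nonneg v.grad u.grad
  linarith

omit [IsFiniteMeasure (volume.restrict Ω)] in
theorem W1p.gap_le (hp : 1 < p) {K : ENNReal} (hK : K ≠ ⊤)
    (hP : ∀ u v g : W1p N Ω p, u.InClass g → v.InClass g →
      eLpNorm (fun x => u.toFun x - v.toFun x) (expo p) (volume.restrict Ω)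
        ≤ K * eLpNorm (fun x => u.grad x - v.grad x) (expo p) (volume.restrict Ω))
    {u v : W1p N Ω p} (hu : u.InClass g) (hv : v.InClass g) {S r : ℝ} (hS : 0 ≤ S)
    (hr : 0 ≤ r) (k : ℕ)
    (h : ∫ x in Ω, ‖v.grad x - u.grad x‖ ^ p ≤ S * r ^ k) :
    u.gap v ≤ (K.toReal + 1) * S ^ p⁻¹ * (r ^ p⁻¹) ^ k := by
  have h1 := toReal_eLpNorm_mono (u.memLp_grad.sub v.memLp_grad) hK (hP u v g hu hv)
  have h2 : (eLpNorm (fun x => u.grad x - v.grad x) (expo p) (volume.restrict Ω)).toReal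
      ≤ S ^ p⁻¹ * (r ^ p⁻¹) ^ k := by
    have h4 : ∫ x in Ω, ‖u.grad x - v.grad x‖ ^ p ≤ S * r ^ k := by
      simp_rw [norm_sub_rev (u.grad _)]
      exact h
    have h5 : (eLpNorm (fun x => u.grad x - v.grad x) (expo p) (volume.restrict Ω)).toReal
        = (∫ x in Ω, ‖u.grad x - v.grad x‖ ^ p) ^ p⁻¹ :=
      toReal_eLpNorm_eq hp (u.memLp_grad.sub v.memLp_grad)
    rw [h5, Real.rpow_pow_comm hr, ← Real.mul_rpow hS (by positivity)]
    exact Real.rpow_le_rpow (integral_nonneg fun x => by positivity) h4 (by positivity)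
  have h3 : (0 : ℝ) ≤ K.toReal := ENNReal.toReal_nonneg
  change _ ≤ K.toReal * (eLpNorm (fun x => u.grad x - v.grad x) (expo p)
    (volume.restrict Ω)).toReal at h1
  rw [W1p.gap]
  nlinarith

end Iteration

/-! ### Linear convergence, and existence of a solution as a limit. -/

section Convergence

variable {N n : ℕ} {Ω : Set (Eu n)} {p μ lam lam' l L : ℝ} {a b : Eu n → Mat N n → Mat N n}
  {f : Eu n → Mat N n} {g : W1p N Ω p} [IsFiniteMeasure (volume.restrict Ω)]

theorem integral_inner_iteration_rhs (ha : IsCoerciveField (volume.restrict Ω) p μ lam a)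
    (hb : IsCoerciveField (volume.restrict Ω) p μ lam' b)
    (hf : MemLp f (conjExpo p) (volume.restrict Ω)) (γ : ℝ) (u : W1p N Ω p) {φ : Eu n → Eu N}
    (hφ : IsTest Ω φ) :
    ∫ x in Ω, inner ℝ (b x (u.grad x) - γ • a x (u.grad x) + γ • f x) (jac φ x)
      = (∫ x in Ω, inner ℝ (b x (u.grad x)) (jac φ x))
        - γ * (∫ x in Ω, inner ℝ (a x (u.grad x)) (jac φ x))
        + γ * ∫ x in Ω, inner ℝ (f x) (jac φ x) := by
  have hJ := hφ.memLp_jac (expo p)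
  have i1 := integrable_inner_of_memLp ha.one_lt (hb.memLp_comp u.memLp_grad) hJ
  have i2 := (integrable_inner_of_memLp ha.one_lt (ha.memLp_comp u.memLp_grad) hJ).const_mul γ
  have i3 := (integrable_inner_of_memLp ha.one_lt hf hJ).const_mul γ
  have i12 : Integrable (fun x => inner ℝ (b x (u.grad x)) (jac φ x)
    - γ * inner ℝ (a x (u.grad x)) (jac φ x)) (volume.restrict Ω) := i1.sub i2
  simp only [inner_add_left, inner_sub_left, real_inner_smul_left]
  rw [integral_add i12 i3, integral_sub i1 i2, integral_const_mul, integral_const_mul]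

/-- A limit of an iteration with a linear rate solves the limit equation. -/
theorem IsKoshelevIteration.isWeakSol_of_tendsto {γ : ℝ} (hγ : 0 < γ) {w : ℕ → W1p N Ω p}
    (ha : IsCoerciveField (volume.restrict Ω) p μ lam a)
    (hb : IsCoerciveField (volume.restrict Ω) p μ lam' b)
    (hf : MemLp f (conjExpo p) (volume.restrict Ω)) (hw : IsKoshelevIteration a b g f γ w)
    {u : W1p N Ω p} (hsum : Summable fun k => ∫ x in Ω, ‖(w k).grad x - u.grad x‖ ^ p) :
    IsWeakSol a f u := by
  intro φ hφ
  have hp := ha.one_lt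
  obtain ⟨M, hM⟩ := hφ.exists_bound_jac
  have hψ := hφ.continuous_jac.aestronglyMeasurable (μ := volume.restrict Ω)
  have ta := ha.tendsto_integral_inner (fun k => (w k).memLp_grad) u.memLp_grad hsum hψ hM
  have tb := hb.tendsto_integral_inner (fun k => (w k).memLp_grad) u.memLp_grad hsum hψ hM
  have e : ∀ k, ∫ x in Ω, inner ℝ (b x ((w (k + 1)).grad x)) (jac φ x)
      = (∫ x in Ω, inner ℝ (b x ((w k).grad x)) (jac φ x))
        - γ * (∫ x in Ω, inner ℝ (a x ((w k).grad x)) (jac φ x))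
        + γ * ∫ x in Ω, inner ℝ (f x) (jac φ x) := fun k =>
    ((hw.2 k).2 φ hφ).trans (integral_inner_iteration_rhs ha hb hf γ (w k) hφ)
  -- The `b`-terms at `k` and `k + 1` have the same limit and cancel, leaving `γ` times the limit
  -- equation.
  have t1 := (tendsto_add_atTop_iff_nat 1).2 tb
  simp_rw [e] at t1
  have t2 := tendsto_nhds_unique t1 ((tb.sub (ta.const_mul γ)).add_const _)
  have : γ * (∫ x in Ω, inner ℝ (a x (u.grad x)) (jac φ x))
      = γ * ∫ x in Ω, inner ℝ (f x) (jac φ x) := by linarith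
  exact mul_left_cancel₀ hγ.ne' this

/-- The rate of convergence of the iteration. -/
noncomputable def iterationRate (p l L : ℝ) : ℝ := √(1 - l / (2 * L)) ^ p⁻¹

theorem iterationRate_pos (hl : 0 < l) (hlL : l ≤ L) : 0 < iterationRate p l L := by
  refine Real.rpow_pos_of_pos (Real.sqrt_pos.2 ?_) _
  rw [sub_pos, div_lt_one (by linarith)]
  linarith

theorem iterationRate_lt_one (hp : 1 < p) (hl : 0 < l) (hlL : l ≤ L) :
    iterationRate p l L < 1 := by
  refine Real.rpow_lt_one (Real.sqrt_nonneg _) ?_ (by positivity)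
  rw [Real.sqrt_lt' one_pos]
  have : 0 < l / (2 * L) := div_pos hl (by linarith)
  linarith

/-- `C` depends on `w` and `v` only through `D`, and energies are compared only up to index `k`. So
`v` may be a solution or a later iterate, the latter with a constant independent of its index. -/
theorem exists_gap_le (hn : 1 ≤ n) (hΩo : IsOpen Ω) (hΩb : Bornology.IsBounded Ω) (hl : 0 < l)
    (hlL : l ≤ L) (ha : IsCoerciveField (volume.restrict Ω) p μ lam a)
    (hb : IsCoerciveField (volume.restrict Ω) p μ lam' b)
    (hf : MemLp f (conjExpo p) (volume.restrict Ω))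
    (hlo : ∀ᵐ x ∂(volume.restrict Ω), ∀ z w, l * bregman (b x) z w ≤ bregman (a x) z w)
    (hup : ∀ᵐ x ∂(volume.restrict Ω), ∀ z w, bregman (a x) z w ≤ L * bregman (b x) z w) (D : ℝ) :
    ∃ C : ℝ, 0 ≤ C ∧ ∀ w : ℕ → W1p N Ω p, IsKoshelevIteration a b g f L⁻¹ w →
      ∀ v : W1p N Ω p, v.InClass g →
      ∫ x in Ω, bregman (b x) (v.grad x) ((w 0).grad x) ≤ D →
      ∫ x in Ω, (μ + ‖v.grad x‖) ^ p ≤ D →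
      ∀ k, (∀ j ≤ k, energy (volume.restrict Ω) a f v.grad
        ≤ energy (volume.restrict Ω) a f (w j).grad) →
      (w k).gap v ≤ C * iterationRate p l L ^ k := by
  have hp := ha.one_lt
  obtain ⟨K, hK, hP⟩ := exists_eLpNorm_sub_le N hn hΩo hΩb hp
  obtain ⟨C, hC, hmain⟩ := integral_rpow_le_of_iteration (ν := volume.restrict Ω) (Mat N n) hp
    ha.mu_nonneg hb.lam_pos hl hlL
  set S := C * max D 0 + max D 0 with hS
  have hS0 : 0 ≤ S := by positivity
  refine ⟨(K.toReal + 1) * S ^ p⁻¹, by positivity, fun w hw v hv hD1 hD2 k hk => ?_⟩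
  refine W1p.gap_le hp hK hP (hw.inClass k) hv hS0 (Real.sqrt_nonneg _) k ?_
  refine (hmain a b f ha hb hf hlo hup v.grad (fun k => (w k).grad) v.memLp_grad
    (fun k => (w k).memLp_grad) (fun k => hw.integral_step ha hb hf hv k) k hk).trans ?_
  have h1 := hD1.trans (le_max_left D 0)
  have h2 := hD2.trans (le_max_left D 0)
  refine mul_le_mul_of_nonneg_right ?_ (by positivity)
  exact add_le_add (mul_le_mul_of_nonneg_left h1 hC.le) h2

/-- Linear convergence of every iteration to any solution. -/
theorem exists_gap_le_of_solvesIn (hn : 1 ≤ n) (hΩo : IsOpen Ω) (hΩb : Bornology.IsBounded Ω)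
    (hl : 0 < l) (hlL : l ≤ L) (ha : IsCoerciveField (volume.restrict Ω) p μ lam a)
    (hb : IsCoerciveField (volume.restrict Ω) p μ lam' b)
    (hf : MemLp f (conjExpo p) (volume.restrict Ω))
    (hlo : ∀ᵐ x ∂(volume.restrict Ω), ∀ z w, l * bregman (b x) z w ≤ bregman (a x) z w)
    (hup : ∀ᵐ x ∂(volume.restrict Ω), ∀ z w, bregman (a x) z w ≤ L * bregman (b x) z w)
    {u : W1p N Ω p} (hu : SolvesIn a g f u) {w : ℕ → W1p N Ω p}
    (hw : IsKoshelevIteration a b g f L⁻¹ w) :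
    ∃ C : ℝ, ∀ k, (w k).gap u ≤ C * iterationRate p l L ^ k := by
  obtain ⟨C, -, h⟩ := exists_gap_le (g := g) hn hΩo hΩb hl hlL ha hb hf hlo hup
    (max (∫ x in Ω, bregman (b x) (u.grad x) ((w 0).grad x)) (∫ x in Ω, (μ + ‖u.grad x‖) ^ p))
  exact ⟨C, fun k => h w hw u hu.1 (le_max_left _ _) (le_max_right _ _) k
    fun j _ => hu.energy_le ha hf (hw.inClass j)⟩

omit [IsFiniteMeasure (volume.restrict Ω)] in
theorem W1p.size_le_gap_add_size (hp : 1 < p) (u v : W1p N Ω p) : u.size ≤ u.gap v + v.size := by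
  have key : ∀ {E : Type} [NormedAddCommGroup E] (s t : Eu n → E),
      MemLp s (expo p) (volume.restrict Ω) → MemLp t (expo p) (volume.restrict Ω) →
      (eLpNorm s (expo p) (volume.restrict Ω)).toReal
        ≤ (eLpNorm (fun x => s x - t x) (expo p) (volume.restrict Ω)).toReal
          + (eLpNorm t (expo p) (volume.restrict Ω)).toReal := by
    intro E _ s t hs ht
    have hst : MemLp (fun x => s x - t x) (expo p) (volume.restrict Ω) := hs.sub ht
    rw [← ENNReal.toReal_add hst.2.ne ht.2.ne]
    refine ENNReal.toReal_mono (ENNReal.add_ne_top.2 ⟨hst.2.ne, ht.2.ne⟩) ?_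
    have e : s = (fun x => s x - t x) + t := by funext x; simp
    conv_lhs => rw [e]
    exact eLpNorm_add_le hst.1 ht.1 (one_le_expo hp)
  have h1 := key u.toFun v.toFun u.memLp v.memLp
  have h2 := key u.grad v.grad u.memLp_grad v.memLp_grad
  simp only [W1p.size, W1p.gap]
  linarith

omit [IsFiniteMeasure (volume.restrict Ω)] in
theorem W1p.ae_eq_of_gap_le_zero (hp : 1 < p) {u v : W1p N Ω p} (h : u.gap v ≤ 0) :
    u.toFun =ᵐ[volume.restrict Ω] v.toFun := by
  have h1 : (eLpNorm (fun x => u.toFun x - v.toFun x) (expo p) (volume.restrict Ω)).toReal = 0 :=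
    le_antisymm ((le_add_of_nonneg_right ENNReal.toReal_nonneg).trans h) ENNReal.toReal_nonneg
  have h2 := (ENNReal.toReal_eq_zero_iff _).1 h1
  have h3 := (eLpNorm_eq_zero_iff (u.memLp.sub v.memLp).1 (expo_ne_zero hp)).1
    (h2.resolve_right (u.memLp.sub v.memLp).2.ne)
  filter_upwards [h3] with x hx
  exact sub_eq_zero.1 hx

/-- Existence of a solution, as the limit of the iteration. -/
theorem exists_solvesIn (hn : 1 ≤ n) (hΩo : IsOpen Ω) (hΩb : Bornology.IsBounded Ω)
    (hl : 0 < l) (hlL : l ≤ L) (ha : IsCoerciveField (volume.restrict Ω) p μ lam a)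
    (hb : IsCoerciveField (volume.restrict Ω) p μ lam' b)
    (hf : MemLp f (conjExpo p) (volume.restrict Ω))
    (hlo : ∀ᵐ x ∂(volume.restrict Ω), ∀ z w, l * bregman (b x) z w ≤ bregman (a x) z w)
    (hup : ∀ᵐ x ∂(volume.restrict Ω), ∀ z w, bregman (a x) z w ≤ L * bregman (b x) z w)
    {w : ℕ → W1p N Ω p} (hw : IsKoshelevIteration a b g f L⁻¹ w) :
    ∃ u : W1p N Ω p, SolvesIn a g f u := by
  have hp := ha.one_lt
  have hL : 0 < L := hl.trans_le hlL
  have hanti := hw.energy_antitone ha hb hf hL hlo hup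
  obtain ⟨K, hK⟩ := ha.exists_bound_of_energy_le hf (w 0).memLp_grad
  -- `K` bounds the Bregman distance of `a`; that of `b` is at most `1/l` times as large.
  obtain ⟨C, hC0, hC⟩ := exists_gap_le (g := g) hn hΩo hΩb hl hlL ha hb hf hlo hup (max (K / l) K)
  set R := iterationRate p l L with hR
  have hR0 : 0 < R := iterationRate_pos hl hlL
  have hR1 : R < 1 := iterationRate_lt_one hp hl hlL
  have hcau : ∀ k m, k ≤ m → (w k).gap (w m) ≤ C * R ^ k := by
    intro k m hkm
    obtain ⟨h1, h2⟩ := hK (w m).grad (w m).memLp_grad (hanti (Nat.zero_le m))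
    refine hC w hw (w m) (hw.inClass m) (le_trans ?_ (le_max_left _ _))
      (h2.trans (le_max_right _ _)) k fun j hj => hanti (hj.trans hkm)
    rw [le_div_iff₀' hl]
    refine le_trans ?_ h1
    rw [← integral_const_mul]
    refine integral_mono_ae ((hb.integrable_bregman (w m).memLp_grad (w 0).memLp_grad).const_mul l)
      (ha.integrable_bregman (w m).memLp_grad (w 0).memLp_grad) ?_
    filter_upwards [hlo] with x hx using hx _ _
  obtain ⟨u, t1, t2⟩ := W1p.exists_limit hp hC0 hR0 hR1 hcau
  -- The Cauchy rate survives `m → ∞`. A rate, not mere convergence, is what provides the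
  -- summability below.
  have hrate : ∀ k, (eLpNorm ((w k).grad - u.grad) (expo p) (volume.restrict Ω)).toReal
      ≤ C * R ^ k := by
    intro k
    have t3 : Tendsto (fun m => C * R ^ k
        + (eLpNorm ((w m).grad - u.grad) (expo p) (volume.restrict Ω)).toReal) atTop
        (𝓝 (C * R ^ k + 0)) :=
      ((ENNReal.tendsto_toReal ENNReal.zero_ne_top).comp t2).const_add _
    rw [add_zero] at t3
    refine ge_of_tendsto t3 ?_
    filter_upwards [eventually_ge_atTop k] with m hm
    have h1 := hcau k m hm
    have m1 := (w k).memLp_grad.sub (w m).memLp_grad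
    have m2 := (w m).memLp_grad.sub u.memLp_grad
    have h2 := eLpNorm_add_le m1.1 m2.1 (one_le_expo hp)
    rw [sub_add_sub_cancel] at h2
    have h3 := ENNReal.toReal_mono (ENNReal.add_ne_top.2 ⟨m1.2.ne, m2.2.ne⟩) h2
    rw [ENNReal.toReal_add m1.2.ne m2.2.ne] at h3
    have h4 : (eLpNorm ((w k).grad - (w m).grad) (expo p) (volume.restrict Ω)).toReal
        ≤ C * R ^ k := le_trans (le_add_of_nonneg_left ENNReal.toReal_nonneg) h1
    linarith
  have hsum : Summable fun k => ∫ x in Ω, ‖(w k).grad x - u.grad x‖ ^ p := by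
    refine Summable.of_nonneg_of_le (fun k => integral_nonneg fun x => by positivity)
      (fun k => ?_) ((summable_geometric_of_lt_one (r := R ^ p) (by positivity)
        (Real.rpow_lt_one hR0.le hR1 (by linarith))).mul_left (C ^ p))
    have h1 : ∫ x in Ω, ‖(w k).grad x - u.grad x‖ ^ p
        = (eLpNorm ((w k).grad - u.grad) (expo p) (volume.restrict Ω)).toReal ^ p :=
      integral_norm_rpow_eq hp ((w k).memLp_grad.sub u.memLp_grad)
    rw [h1, Real.rpow_pow_comm hR0.le, ← Real.mul_rpow hC0 (by positivity)]
    exact Real.rpow_le_rpow ENNReal.toReal_nonneg (hrate k) (by linarith)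
  exact ⟨u, W1p.InClass.of_tendsto hp (fun k => hw.inClass k) t1 t2,
    hw.isWeakSol_of_tendsto (inv_pos.2 hL) ha hb hf hsum⟩

/-- The constant sequence at a solution is an iteration. -/
theorem SolvesIn.isKoshelevIteration_const {γ : ℝ}
    (ha : IsCoerciveField (volume.restrict Ω) p μ lam a)
    (hb : IsCoerciveField (volume.restrict Ω) p μ lam' b)
    (hf : MemLp f (conjExpo p) (volume.restrict Ω)) {u : W1p N Ω p} (hu : SolvesIn a g f u) :
    IsKoshelevIteration a b g f γ fun _ => u := by
  refine ⟨hu.1, fun _ => ⟨hu.1, fun φ hφ => ?_⟩⟩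
  refine Eq.trans ?_ (integral_inner_iteration_rhs ha hb hf γ u hφ).symm
  rw [hu.2 φ hφ]
  ring

end Convergence

end Koshelev

theorem theorem1p1 {N n : ℕ} (hn : 1 ≤ n) (Ω : Set (Eu n)) (hΩ_open : IsOpen Ω)
    (hΩ_conn : IsConnected Ω) (hΩ_bdd : Bornology.IsBounded Ω)
    (p : ℝ) (hp : 1 < p) (μ lam_a Lam_a lam_b Lam_b lam_ab Lam_ab : ℝ)
    (a b : Eu n → Mat N n → Mat N n)
    (ha : IsEllipticField Ω p μ lam_a Lam_a a)
    (hb : IsEllipticField Ω p μ lam_b Lam_b b)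
    (f : Eu n → Mat N n) (hf : MemLp f (conjExpo p) (volume.restrict Ω))
    (g : W1p N Ω p)
    (hb_solv : ∀ F : Eu n → Mat N n, MemLp F (conjExpo p) (volume.restrict Ω) →
      UniquelySolvable b g F)
    (hab_pos : 0 < lam_ab) (hab_le : lam_ab ≤ Lam_ab)
    (hab : EigenvalueBounds Ω p μ a b lam_ab Lam_ab)
    (hsmall_ge : 2 ≤ p →
      Lam_b / lam_b * dispersion lam_ab Lam_ab * ((3 + Real.sqrt 5) / 2) ^ ((p - 2) / (2 * p))
        * 6 ^ (p - 2) * (p - 1) < 1)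
    (hsmall_le : p ≤ 2 →
      Lam_b / lam_b * dispersion lam_ab Lam_ab * ((3 - Real.sqrt 5) / 2) ^ ((p - 2) / 4)
        * (2 ^ (2 - p) / (p - 1)) < 1) :
    UniquelySolvable a g f ∧
    ∃ γ : ℝ, 0 < γ ∧ ∃ R : ℝ, 0 < R ∧ R < 1 ∧
      (∀ u₀ : W1p N Ω p, u₀.InClass g →
        ∃ w : ℕ → W1p N Ω p, w 0 = u₀ ∧ IsKoshelevIteration a b g f γ w) ∧
      ∀ u : W1p N Ω p, SolvesIn a g f u →
        ∀ w : ℕ → W1p N Ω p, IsKoshelevIteration a b g f γ w →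
          (∃ M : ℝ, ∀ k : ℕ, (w k).size ≤ M) ∧
          Tendsto (fun k => (w k).gap u) atTop (𝓝 0) ∧
          ∃ C : ℝ, ∀ k : ℕ, (w k).gap u ≤ C * R ^ k := by

  have hfin : IsFiniteMeasure (volume.restrict Ω) :=
    isFiniteMeasure_restrict.2 hΩ_bdd.measure_lt_top.ne
  have hca := ha.isCoerciveField hΩ_open hp
  have hcb := hb.isCoerciveField hΩ_open hp
  obtain ⟨hlo, hup⟩ := hab.bregman_bounds hΩ_open hp ha hb
  have hLpos : 0 < Lam_ab := hab_pos.trans_le hab_le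
  have hR0 := iterationRate_pos (p := p) hab_pos hab_le
  have hR1 := iterationRate_lt_one hp hab_pos hab_le
  have hpow : ∀ C : ℝ, Tendsto (fun k : ℕ => C * iterationRate p lam_ab Lam_ab ^ k) atTop (𝓝 0) := by
    intro C
    simpa using (tendsto_pow_atTop_nhds_zero_of_lt_one hR0.le hR1).const_mul C
  refine ⟨?_, Lam_ab⁻¹, inv_pos.2 hLpos, iterationRate p lam_ab Lam_ab, hR0, hR1,
    fun u₀ hu₀ => exists_iteration hca hcb hf hb_solv _ hu₀, fun u hu w hw => ?_⟩
  -- Any starting point in the class would do; `g` itself is at hand.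
  · obtain ⟨w, -, hw⟩ := exists_iteration hca hcb hf hb_solv Lam_ab⁻¹ g.inClass_self
    obtain ⟨u, hu⟩ := exists_solvesIn hn hΩ_open hΩ_bdd hab_pos hab_le hca hcb hf hlo hup hw
    refine ⟨u, hu, fun v hv => ?_⟩
    -- The iteration resting at `v` has constant distance to `u`, yet that distance is at most `C
    -- R^k` for every `k`.
    obtain ⟨C, hC⟩ := exists_gap_le_of_solvesIn hn hΩ_open hΩ_bdd hab_pos hab_le hca hcb hf hlo hup
      hu (hv.isKoshelevIteration_const hca hcb hf)
    exact W1p.ae_eq_of_gap_le_zero hp (ge_of_tendsto (hpow C) (Eventually.of_forall hC))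
  · obtain ⟨C, hC⟩ := exists_gap_le_of_solvesIn hn hΩ_open hΩ_bdd hab_pos hab_le hca hcb hf hlo hup
      hu hw
    have htend : Tendsto (fun k => (w k).gap u) atTop (𝓝 0) :=
      squeeze_zero (fun k => add_nonneg ENNReal.toReal_nonneg ENNReal.toReal_nonneg) hC (hpow C)
    obtain ⟨M, hM⟩ := htend.bddAbove_range
    refine ⟨⟨M + u.size, fun k => (W1p.size_le_gap_add_size hp (w k) u).trans ?_⟩, htend, C, hC⟩
    exact add_le_add (hM ⟨k, rfl⟩) le_rfl
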